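/- Let $\mathbb P(d)$ be the set of symmetric positive definite real $d\times d$ matrices. Let $\nu$ be a probability law on $\mathbb R^d$, square integrable with mean $0$ and identity covariance, invariant under all rotations in $SO(d)$ (so an elliptical family if $d\ge 2$; no symmetry is required if $d=1$). For $m\in\mathbb R^d$, $S\in\mathbb P(d)$ let $LS(m,S)$ be the law of $m+S^{1/2}Z_0$, $Z_0\sim\nu$. Let $\gamma>0$, let $w$ be a weight vector ($w_i\ge 0$, $\sum_{i=1}^n w_i=1$), and let the priors be $\mu_i=LS(m_i,S_i)$ with $m_i\in\mathbb R^d$, $S_i\in\mathbb P(d)$, $i=1,\dots,n$. Let $W_2$ be the $2$-Wasserstein distance and $$F_{\mathcal M}(\mu)=\sum_{i}w_iW_2^2(\mu,\mu_i)-V_{\mathcal M},\qquad V_{\mathcal M}=\inf_{\mu'\in\mathcal P(\mathbb R^d)}\sum_iw_iW_2^2(\mu',\mu_i).$$ Let the position be $-X=\Phi_0(Z)$, where $\Phi_0:\mathbb R^d\to\mathbb R$ is Borel measurable and $z\mapsto\Phi_0(m+S^{1/2}z)$ is $\nu$-integrable for all $(m,S)\in\mathbb R^d\times\mathbb P(d)$,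 and let $\Phi(m,S)=\int\Phi_0(m+S^{1/2}z)\,d\nu(z)$. It is agreed that the risk factors $Z$ follow the location–scatter family generated by $\nu$, with unknown parameters, so that the Wasserstein barycentric risk measure is $$\rho_W(X)=\sup\Big\{\mathbb E_\mu[-X]-\tfrac1{2\gamma}F_{\mathcal M}(\mu)\ :\ \mu=LS(m,S),\ (m,S)\in\mathbb R^d\times\mathbb P(d)\Big\}.$$ **(i)** In $(-\infty,\infty]$, $$\rho_W(X)=\sup_{(m,S)\in\mathbb R^d\times\mathbb P(d)}\Big\{\Phi(m,S)-\tfrac1{2\gamma}\big(\overline F_{\mathcal M}(m)+F^0_{\mathcal M}(S)\big)\Big\},$$ where, with $m_B=\sum_iw_im_i$, $$\overline F_{\mathcal M}(m)=\sum_iw_i\|m-m_i\|^2-\sum_iw_i\|m_B-m_i\|^2,$$ $$F^0_{\mathcal M}(S)=\mathbb F^0(S)-\inf_{S'\in\mathbb P(d)}\mathbb F^0(S'),\qquad \mathbb F^0(S)=\sum_iw_i\operatorname{Tr}\big(S+S_i-2(S_i^{1/2}SS_i^{1/2})^{1/2}\big).$$ **(ii)** Suppose moreover that $\Phi_0$ is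 $C^1$, and let $(m,S)\in\mathbb R^d\times\mathbb P(d)$ have a neighbourhood on which $\|D\Phi_0(m'+S'^{1/2}z)\|(1+\|z\|)$, for $S'\in\mathbb P(d)$, is bounded by one $\nu$-integrable function of $z$. Put $$D_m\Phi=\Big(\int D_\ell\Phi_0(m+S^{1/2}z)\,d\nu(z)\Big)_{\ell},\quad \Psi_{\ell k}=\int D_\ell\Phi_0(m+S^{1/2}z)z_k\,d\nu(z),\quad D_S\Phi=\tfrac14\big(\Psi S^{-1/2}+S^{-1/2}\Psi^{T}\big).$$ Then $D_m\Phi$ and $D_S\Phi$ are the gradients of $\Phi$ at $(m,S)$: for every $h\in\mathbb R^d$ and every symmetric $H$, $$\tfrac{d}{d\varepsilon}\Phi(m+\varepsilon h,S+\varepsilon H)\big|_{\varepsilon=0}=\langle D_m\Phi,h\rangle+\operatorname{Tr}(D_S\Phi\,H).$$ If $(m,S)$ is a maximizer of the problem in (i), then $$\gamma D_m\Phi(m,S)-\Big(m-\sum_iw_im_i\Big)=0,$$ $$2\gamma S^{1/2}D_S\Phi(m,S)S^{1/2}-\Big(S-\sum_iw_i(S^{1/2}S_iS^{1/2})^{1/2}\Big)=0.$$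 -/

import Mathlib

open MeasureTheory Matrix
open scoped ENNReal MatrixOrder Topology

noncomputable section

namespace BarycentricRisk

/-- The space of risk factors, `ℝ^d` with its Euclidean norm. -/
abbrev Vec (d : ℕ) : Type := EuclideanSpace ℝ (Fin d)

/-- Real `d × d` matrices. -/
abbrev Mat (d : ℕ) : Type := Matrix (Fin d) (Fin d) ℝ

variable {d n : ℕ}

/-! ### Wasserstein distance, Fréchet function and the risk measure -/

/-- Transport plans between `μ` and `μ'`: measures on `ℝ^d × ℝ^d` with marginals `μ`, `μ'`. -/
def transportPlans (μ μ' : ProbabilityMeasure (Vec d)) : Set (Measure (Vec d × Vec d)) :=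
  {π | π.fst = (μ : Measure (Vec d)) ∧ π.snd = (μ' : Measure (Vec d))}

/-- The `2`-Wasserstein distance, with value `∞` allowed on laws without second moments. -/
def W2 (μ μ' : ProbabilityMeasure (Vec d)) : ℝ≥0∞ :=
  (⨅ π ∈ transportPlans μ μ', ∫⁻ p, edist p.1 p.2 ^ 2 ∂π) ^ (1 / 2 : ℝ)

/-- `∑ᵢ wᵢ W₂²(μ, μᵢ)`. -/
def frechetFun (w : Fin n → ℝ) (prior : Fin n → ProbabilityMeasure (Vec d))
    (μ : ProbabilityMeasure (Vec d)) : ℝ≥0∞ :=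
  ∑ i, ENNReal.ofReal (w i) * W2 μ (prior i) ^ 2

/-- The Fréchet variance: the infimum of the Fréchet function over all laws on `ℝ^d`. -/
def frechetVar (w : Fin n → ℝ) (prior : Fin n → ProbabilityMeasure (Vec d)) : ℝ≥0∞ :=
  ⨅ μ : ProbabilityMeasure (Vec d), frechetFun w prior μ

/-- The normalized Fréchet function. -/
def normFrechetFun (w : Fin n → ℝ) (prior : Fin n → ProbabilityMeasure (Vec d))
    (μ : ProbabilityMeasure (Vec d)) : ℝ≥0∞ :=
  frechetFun w prior μ - frechetVar w prior

/-- The expectation `E_μ[f] = E_μ[f⁺] - E_μ[f⁻]` with values in `[-∞, ∞]`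
(`-∞` if both parts are infinite, so that such a law does not contribute to a supremum). -/
def expect (μ : ProbabilityMeasure (Vec d)) (f : Vec d → ℝ) : EReal :=
  ((∫⁻ z, ENNReal.ofReal (f z) ∂(μ : Measure (Vec d)) : ℝ≥0∞) : EReal) -
    ((∫⁻ z, ENNReal.ofReal (-f z) ∂(μ : Measure (Vec d)) : ℝ≥0∞) : EReal)

/-- The Wasserstein barycentric risk measure of the position `X`, where `admissible` is the set of
the laws of the risk factors that are considered possible:
`sup_{μ ∈ admissible} { E_μ[-X] - F_M(μ) / (2 γ) }`. -/
def wassersteinRisk (admissible : Set (ProbabilityMeasure (Vec d))) (γ : ℝ) (w : Fin n → ℝ)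
    (prior : Fin n → ProbabilityMeasure (Vec d)) (X : Vec d → ℝ) : EReal :=
  ⨆ μ ∈ admissible, (expect μ (fun z => -X z) -
    ((ENNReal.ofReal (1 / (2 * γ)) * normFrechetFun w prior μ : ℝ≥0∞) : EReal))

/-! ### Location-scatter families -/

/-- The affine map `z ↦ m + S^{1/2} z`. -/
def lsMap (m : Vec d) (S : Mat d) (z : Vec d) : Vec d :=
  m + Matrix.toEuclideanCLM (𝕜 := ℝ) (CFC.sqrt S) z

theorem continuous_lsMap (m : Vec d) (S : Mat d) : Continuous (lsMap m S) := by
  unfold lsMap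
  fun_prop

/-- `LS(m, S)`: the law of `m + S^{1/2} Z₀` where `Z₀` has law `ν`. -/
def LS (ν : ProbabilityMeasure (Vec d)) (m : Vec d) (S : Mat d) : ProbabilityMeasure (Vec d) :=
  ν.map (continuous_lsMap m S).measurable.aemeasurable

/-- The location-scatter family generated by `ν`. -/
def lsFamily (ν : ProbabilityMeasure (Vec d)) : Set (ProbabilityMeasure (Vec d)) :=
  {μ | ∃ (m : Vec d) (S : Mat d), S.PosDef ∧ μ = LS ν m S}

/-- `ν` is the law of a standardized central variable of an elliptical family: it is square
integrable with mean zero and identity covariance, and it is invariant under rotations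
(matrices in `SO(d)`; no symmetry is asked for when `d = 1`). -/
structure IsCentralLaw (ν : ProbabilityMeasure (Vec d)) : Prop where
  memLp : MemLp (fun z : Vec d => z) 2 (ν : Measure (Vec d))
  mean : ∫ z, z ∂(ν : Measure (Vec d)) = 0
  cov : ∀ k l, ∫ z, z k * z l ∂(ν : Measure (Vec d)) = (1 : Mat d) k l
  rotation : ∀ U ∈ Matrix.specialOrthogonalGroup (Fin d) ℝ,
    (ν : Measure (Vec d)).map (Matrix.toEuclideanCLM (𝕜 := ℝ) U) = (ν : Measure (Vec d))

/-! ### The matrix problem -/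

/-- `∑ᵢ wᵢ mᵢ`. -/
def meanBary (w : Fin n → ℝ) (ms : Fin n → Vec d) : Vec d := ∑ i, w i • ms i

/-- `∑ᵢ wᵢ ‖m - mᵢ‖²`. -/
def locFrechet (w : Fin n → ℝ) (ms : Fin n → Vec d) (m : Vec d) : ℝ :=
  ∑ i, w i * ‖m - ms i‖ ^ 2

/-- The normalized location part `F̄_M(m)`. -/
def locPenalty (w : Fin n → ℝ) (ms : Fin n → Vec d) (m : Vec d) : ℝ :=
  locFrechet w ms m - locFrechet w ms (meanBary w ms)

/-- `∑ᵢ wᵢ Tr(S + Sᵢ - 2 (Sᵢ^{1/2} S Sᵢ^{1/2})^{1/2})`. -/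
def scatFrechet (w : Fin n → ℝ) (Ss : Fin n → Mat d) (S : Mat d) : ℝ :=
  ∑ i, w i * (S + Ss i -
    (2 : ℝ) • CFC.sqrt (CFC.sqrt (Ss i) * S * CFC.sqrt (Ss i))).trace

/-- The infimum of `scatFrechet` over the positive definite matrices. -/
def scatVar (w : Fin n → ℝ) (Ss : Fin n → Mat d) : ℝ :=
  ⨅ S : {S : Mat d // S.PosDef}, scatFrechet w Ss S.1

/-- The normalized scatter part `F⁰_M(S)`. -/
def scatPenalty (w : Fin n → ℝ) (Ss : Fin n → Mat d) (S : Mat d) : ℝ :=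
  scatFrechet w Ss S - scatVar w Ss

/-- `Φ(m, S) = ∫ Φ₀(m + S^{1/2} z) dν(z)`. -/
def riskFun (ν : ProbabilityMeasure (Vec d)) (Φ₀ : Vec d → ℝ) (m : Vec d) (S : Mat d) : ℝ :=
  ∫ z, Φ₀ (lsMap m S z) ∂(ν : Measure (Vec d))

/-- The objective `Φ(m, S) - (F̄_M(m) + F⁰_M(S)) / (2 γ)`. -/
def objective (ν : ProbabilityMeasure (Vec d)) (Φ₀ : Vec d → ℝ) (γ : ℝ) (w : Fin n → ℝ)
    (ms : Fin n → Vec d) (Ss : Fin n → Mat d) (p : Vec d × Mat d) : ℝ :=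
  riskFun ν Φ₀ p.1 p.2 - 1 / (2 * γ) * (locPenalty w ms p.1 + scatPenalty w Ss p.2)

/-- The feasible set `ℝ^d × ℙ(d)`, with `ℙ(d)` the symmetric positive definite matrices. -/
def feasible (d : ℕ) : Set (Vec d × Mat d) := {p | p.2.PosDef}

/-! ### Derivatives of the risk function -/

/-- The partial derivative `D_ℓ Φ₀`. -/
def partialD (Φ₀ : Vec d → ℝ) (l : Fin d) (x : Vec d) : ℝ :=
  fderiv ℝ Φ₀ x (EuclideanSpace.single l 1)

/-- `D_m Φ(m, S)`: the vector with entries `Φ_ℓ = ∫ D_ℓ Φ₀(m + S^{1/2} z) dν(z)`. -/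
def gradM (ν : ProbabilityMeasure (Vec d)) (Φ₀ : Vec d → ℝ) (m : Vec d) (S : Mat d) : Vec d :=
  WithLp.toLp 2 fun l => ∫ z, partialD Φ₀ l (lsMap m S z) ∂(ν : Measure (Vec d))

/-- The matrix with entries `Ψ_{ℓ,k} = ∫ D_ℓ Φ₀(m + S^{1/2} z) z_k dν(z)`. -/
def psiMat (ν : ProbabilityMeasure (Vec d)) (Φ₀ : Vec d → ℝ) (m : Vec d) (S : Mat d) : Mat d :=
  Matrix.of fun l k => ∫ z, partialD Φ₀ l (lsMap m S z) * z k ∂(ν : Measure (Vec d))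

/-- `D_S Φ(m, S) = (Ψ S^{-1/2} + S^{-1/2} Ψᵀ) / 4`. The factor `1/4` is the one for which this is
the gradient of `Φ` in `S` with respect to `⟨A, B⟩ = Tr(A B)`; for instance it gives `A` when
`Φ₀(z) = ⟨z, A z⟩` with `A` symmetric, where `Φ(m, S) = ⟨m, A m⟩ + Tr(A S)`. -/
def gradS (ν : ProbabilityMeasure (Vec d)) (Φ₀ : Vec d → ℝ) (m : Vec d) (S : Mat d) : Mat d :=
  (1 / 4 : ℝ) • (psiMat ν Φ₀ m S * (CFC.sqrt S)⁻¹ + (CFC.sqrt S)⁻¹ * (psiMat ν Φ₀ m S)ᵀ)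

/-- Domination near `(m, S)`, as needed to differentiate `Φ` under the integral: for some
neighbourhood `N` of `(m, S)` a single `ν`-integrable function bounds
`‖DΦ₀(m' + S'^{1/2} z)‖ (1 + ‖z‖)` for all `(m', S')` in `N` with `S'` positive definite. -/
def DominatedNear (ν : ProbabilityMeasure (Vec d)) (Φ₀ : Vec d → ℝ) (m : Vec d) (S : Mat d) :
    Prop :=
  ∃ N ∈ 𝓝 (m, S), ∃ g : Vec d → ℝ, Integrable g (ν : Measure (Vec d)) ∧
    ∀ᵐ z ∂(ν : Measure (Vec d)), ∀ p ∈ N, p.2.PosDef →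
      ‖fderiv ℝ Φ₀ (lsMap p.1 p.2 z)‖ * (1 + ‖z‖) ≤ g z

end BarycentricRisk

end

namespace BarycentricRisk

open scoped Matrix.Norms.L2Operator

/-! ### Matrix square roots, optimal transport matrices and the derivative of the root. -/

section MatrixFacts

variable {d : ℕ} {S S' : Mat d}

/-! Part (i) rests on the formula that `W2 ^ 2` between `LS ν m S` and `LS ν m' S'` is `‖m - m'‖²`
plus the Bures term in `S`, `S'`. Both bounds come from the matrix `T = brenier S S'`, which
satisfies `T S T = S'`. Upper bound (`W2_sq_LS_le`): `T S^{1/2} = S'^{1/2} U` with `U` in `SO(d)`,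
so rotation invariance of `ν` makes the affine map with linear part `T` carry one law to the other,
and its cost is a quadratic moment. Lower bound (`gelbrich_le_W2_sq`): Young's inequality `2⟨u, v⟩ ≤
⟨u, T u⟩ + ⟨v, T⁻¹ v⟩` gives quadratic dual potentials, whose integrals see only means and
covariances.

The lower bound therefore holds for every square integrable law, and a law of finite Fréchet value
is square integrable. Hence the Fréchet variance over all laws equals the value of the matrix
problem (`frechetVar_LS`), where the location part is minimal at the mean barycentre. The two
suprema in (i) then agree term by term.

For part (ii), the derivative `L` of the root in direction `H` solves `S^{1/2} L + L S^{1/2} = H`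
(inverse function theorem for squaring). Differentiation under the integral yields `⟨D_m Φ, h⟩ +
Tr(Ψᵀ L)`. Invariance under infinitesimal rotations makes `Ψᵀ S^{1/2}` symmetric, which turns `Tr(Ψᵀ
L)` into `Tr(D_S Φ H)`. The Bures terms have gradients `1 - brenier S (Ss i)`. Stationarity, tested
on the residuals themselves and conjugated by `S^{1/2}`, gives the first order conditions. -/

theorem sqrt_posSemidef (S : Mat d) : (CFC.sqrt S).PosSemidef :=
  Matrix.nonneg_iff_posSemidef.1 (CFC.sqrt_nonneg S)

theorem sqrt_mul_sqrt (hS : S.PosSemidef) : CFC.sqrt S * CFC.sqrt S = S :=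
  CFC.sqrt_mul_sqrt_self S (Matrix.nonneg_iff_posSemidef.2 hS)

theorem sqrt_mul_self_eq (hS : S.PosSemidef) : CFC.sqrt (S * S) = S :=
  CFC.sqrt_mul_self S (Matrix.nonneg_iff_posSemidef.2 hS)

theorem sqrt_posDef (hS : S.PosDef) : (CFC.sqrt S).PosDef :=
  Matrix.isStrictlyPositive_iff_posDef.1
    (IsStrictlyPositive.sqrt S (Matrix.isStrictlyPositive_iff_posDef.2 hS))

theorem posDef_conj {A : Mat d} (hS : S.PosDef) (hA : A.PosDef) : (A * S * A).PosDef := by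
  have h := hS.mul_mul_conjTranspose_same (B := A)
    (Matrix.vecMul_injective_iff_isUnit.2 hA.isUnit)
  rwa [hA.1.eq] at h

theorem _root_.Matrix.PosDef.mul_inv_self {A : Mat d} (hA : A.PosDef) : A * A⁻¹ = 1 :=
  Matrix.mul_nonsing_inv A ((Matrix.isUnit_iff_isUnit_det A).1 hA.isUnit)

theorem _root_.Matrix.PosDef.inv_mul_self {A : Mat d} (hA : A.PosDef) : A⁻¹ * A = 1 :=
  Matrix.nonsing_inv_mul A ((Matrix.isUnit_iff_isUnit_det A).1 hA.isUnit)

/-- The matrix of the optimal transport map from scatter `S` to scatter `S'`. -/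
noncomputable def brenier (S S' : Mat d) : Mat d :=
  CFC.sqrt S' * (CFC.sqrt (CFC.sqrt S' * S * CFC.sqrt S'))⁻¹ * CFC.sqrt S'

theorem brenier_posDef (hS : S.PosDef) (hS' : S'.PosDef) : (brenier S S').PosDef :=
  posDef_conj (sqrt_posDef (posDef_conj hS (sqrt_posDef hS'))).inv (sqrt_posDef hS')

theorem inv_mul_conj_mul_inv (hS : S.PosDef) (hS' : S'.PosDef) :
    (CFC.sqrt (CFC.sqrt S' * S * CFC.sqrt S'))⁻¹ * (CFC.sqrt S' * S * CFC.sqrt S') =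
      CFC.sqrt (CFC.sqrt S' * S * CFC.sqrt S') := by
  have hK := posDef_conj hS (sqrt_posDef hS')
  nth_rewrite 2 [← sqrt_mul_sqrt hK.posSemidef]
  rw [← Matrix.mul_assoc, (sqrt_posDef hK).inv_mul_self, Matrix.one_mul]

/-- With `R' = S'^{1/2}` and `K = R' S R'`, the product is `R' K^{-1/2} K K^{-1/2} R' = R' R'`. So
the linear map `T` carries covariance `S` to `S'`. -/
theorem brenier_mul_mul_brenier (hS : S.PosDef) (hS' : S'.PosDef) :
    brenier S S' * S * brenier S S' = S' := by
  have hK := posDef_conj hS (sqrt_posDef hS')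
  calc brenier S S' * S * brenier S S'
      = CFC.sqrt S' * ((CFC.sqrt (CFC.sqrt S' * S * CFC.sqrt S'))⁻¹ *
          (CFC.sqrt S' * S * CFC.sqrt S')) *
          (CFC.sqrt (CFC.sqrt S' * S * CFC.sqrt S'))⁻¹ * CFC.sqrt S' := by
        simp only [brenier, Matrix.mul_assoc]
    _ = S' := by
        rw [inv_mul_conj_mul_inv hS hS', Matrix.mul_assoc (CFC.sqrt S'),
          (sqrt_posDef hK).mul_inv_self, Matrix.mul_one, sqrt_mul_sqrt hS'.posSemidef]

theorem trace_brenier_mul (hS : S.PosDef) (hS' : S'.PosDef) :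
    (brenier S S' * S).trace = (CFC.sqrt (CFC.sqrt S' * S * CFC.sqrt S')).trace := by
  conv_rhs => rw [← inv_mul_conj_mul_inv hS hS']
  rw [brenier, Matrix.mul_assoc, Matrix.mul_assoc, Matrix.trace_mul_comm]
  simp only [Matrix.mul_assoc]

theorem inv_brenier_mul (hS : S.PosDef) (hS' : S'.PosDef) :
    (brenier S S')⁻¹ * S' = S * brenier S S' := by
  have h := congrArg ((brenier S S')⁻¹ * ·) (brenier_mul_mul_brenier hS hS')
  simp only [Matrix.mul_assoc] at h
  rw [← h, ← Matrix.mul_assoc, (brenier_posDef hS hS').inv_mul_self, Matrix.one_mul]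

/-- Together with `trace_brenier_mul`: at this `T` both trace terms of the dual bound coincide,
which produces the factor 2 of the Bures term. -/
theorem trace_inv_brenier_mul (hS : S.PosDef) (hS' : S'.PosDef) :
    ((brenier S S')⁻¹ * S').trace = (CFC.sqrt (CFC.sqrt S' * S * CFC.sqrt S')).trace := by
  rw [inv_brenier_mul hS hS', Matrix.trace_mul_comm, trace_brenier_mul hS hS']

/-- The left side is positive definite and its square is `S^{1/2} (T S T) S^{1/2}`. This brings the
stationarity condition into its final form. -/
theorem sqrt_mul_brenier_mul_sqrt (hS : S.PosDef) (hS' : S'.PosDef) :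
    CFC.sqrt S * brenier S S' * CFC.sqrt S = CFC.sqrt (CFC.sqrt S * S' * CFC.sqrt S) := by
  rw [← sqrt_mul_self_eq (posDef_conj (brenier_posDef hS hS') (sqrt_posDef hS)).posSemidef]
  congr 1
  conv_rhs => rw [← brenier_mul_mul_brenier hS hS']
  conv_rhs => enter [1, 2, 1, 2]; rw [← sqrt_mul_sqrt hS.posSemidef]
  simp only [Matrix.mul_assoc]

/-- Polar decomposition of the transported root, with a rotation as its orthogonal factor. -/
theorem exists_rotation_brenier_mul_sqrt (hS : S.PosDef) (hS' : S'.PosDef) :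
    ∃ U ∈ Matrix.specialOrthogonalGroup (Fin d) ℝ,
      brenier S S' * CFC.sqrt S = CFC.sqrt S' * U := by
  have hR := sqrt_posDef hS
  have hR' := sqrt_posDef hS'
  have hT := brenier_posDef hS hS'
  refine ⟨(CFC.sqrt S')⁻¹ * (brenier S S' * CFC.sqrt S), ?_, ?_⟩
  · rw [Matrix.mem_specialOrthogonalGroup_iff]
    have ho : (CFC.sqrt S')⁻¹ * (brenier S S' * CFC.sqrt S) ∈
        Matrix.orthogonalGroup (Fin d) ℝ := by
      rw [Matrix.mem_orthogonalGroup_iff, ← Matrix.conjTranspose_eq_transpose_of_trivial,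
        Matrix.conjTranspose_mul, Matrix.conjTranspose_mul, hR'.inv.1.eq, hT.1.eq, hR.1.eq]
      calc _ = (CFC.sqrt S')⁻¹ * (brenier S S' * (CFC.sqrt S * CFC.sqrt S) * brenier S S') *
            (CFC.sqrt S')⁻¹ := by simp only [Matrix.mul_assoc]
        _ = 1 := by
          rw [sqrt_mul_sqrt hS.posSemidef, brenier_mul_mul_brenier hS hS']
          nth_rewrite 2 [← sqrt_mul_sqrt hS'.posSemidef]
          rw [← Matrix.mul_assoc, hR'.inv_mul_self, Matrix.one_mul, hR'.mul_inv_self]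
    refine ⟨ho, ?_⟩
    -- All three factors have positive determinant, which rules out determinant `-1`.
    have hpos : 0 < ((CFC.sqrt S')⁻¹ * (brenier S S' * CFC.sqrt S)).det := by
      rw [Matrix.det_mul, Matrix.det_mul]
      exact mul_pos hR'.inv.det_pos (mul_pos hT.det_pos hR.det_pos)
    have h1 := congrArg Matrix.det ((Matrix.mem_orthogonalGroup_iff _ _).1 ho)
    rw [Matrix.det_mul, Matrix.det_transpose, Matrix.det_one] at h1
    nlinarith
  · rw [← Matrix.mul_assoc, hR'.mul_inv_self, Matrix.one_mul]

/-- Positive definiteness persists under small hermitian perturbations. -/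
theorem eventually_posDef (hS : S.PosDef) : ∀ᶠ A in 𝓝 S, A.IsHermitian → A.PosDef := by
  -- For `d = 0` the identity `‖1‖ = 1` used below fails.
  rcases isEmpty_or_nonempty (Fin d) with hd | hd
  · exact Filter.Eventually.of_forall fun A _ => by rwa [Subsingleton.elim A S]
  obtain ⟨c, hc, hcS⟩ := (CFC.exists_pos_algebraMap_le_iff (A := Mat d) (a := S) hS.1).2
    fun x hx => (Matrix.isStrictlyPositive_iff_posDef.2 hS).spectrum_pos hx
  -- Here `S ≥ c`, and a hermitian `A - S` of norm below `c / 2` is at least `-c / 2`, so `A ≥ c /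
  -- 2`.
  filter_upwards [Metric.ball_mem_nhds S (half_pos hc)] with A hA hAh
  have h1 : (A - S).IsHermitian := hAh.sub hS.1
  have h2 : algebraMap ℝ (Mat d) (-(c / 2)) ≤ A - S := by
    rw [algebraMap_le_iff_le_spectrum (a := A - S) (ha := h1)]
    intro x hx
    have h3 : ‖x‖ ≤ ‖A - S‖ * ‖(1 : Mat d)‖ := spectrum.norm_le_norm_mul_of_mem hx
    have h4 : ‖A - S‖ < c / 2 := by rw [← dist_eq_norm]; exact Metric.mem_ball.1 hA
    rw [CStarRing.norm_one, mul_one, Real.norm_eq_abs] at h3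
    linarith [neg_abs_le x]
  have h3 : algebraMap ℝ (Mat d) (c / 2) ≤ A := by
    have h6 := add_le_add hcS h2
    rw [← map_add, add_sub_cancel] at h6
    convert h6 using 2
    ring
  have h7 : (algebraMap ℝ (Mat d) (c / 2)).PosDef := by
    rw [Algebra.algebraMap_eq_smul_one]
    exact Matrix.PosDef.one.smul (half_pos hc)
  simpa using h7.add_posSemidef (Matrix.le_iff.1 h3)

/-! ### The derivative of the square root -/

/-- The operator `X ↦ R X + X R`. -/
noncomputable def sylvester (R : Mat d) : Mat d →ₗ[ℝ] Mat d :=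
  LinearMap.mulLeft ℝ R + LinearMap.mulRight ℝ R

theorem sylvester_apply (R X : Mat d) : sylvester R X = R * X + X * R := rfl

theorem eq_zero_of_trace_conj_eq_zero {R X : Mat d} (hR : R.PosDef)
    (h : (Xᴴ * R * X).trace = 0) : X = 0 := by
  have h1 := ((hR.posSemidef.conjTranspose_mul_mul_same X).trace_eq_zero_iff).1 h
  have hQ := sqrt_posDef hR
  have h2 : (CFC.sqrt R * X)ᴴ * (CFC.sqrt R * X) = 0 := by
    rw [Matrix.conjTranspose_mul, hQ.1.eq, ← h1]
    conv_rhs => rw [← sqrt_mul_sqrt hR.posSemidef]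
    simp only [Matrix.mul_assoc]
  have h3 := Matrix.conjTranspose_mul_self_eq_zero.1 h2
  calc X = (CFC.sqrt R)⁻¹ * (CFC.sqrt R * X) := by
        rw [← Matrix.mul_assoc, hQ.inv_mul_self, Matrix.one_mul]
    _ = 0 := by rw [h3, Matrix.mul_zero]

/-- Pairing `R X + X R = 0` with `Xᴴ` gives two nonnegative traces with sum zero. In finite
dimension injectivity makes the operator invertible, as the inverse function theorem requires. -/
theorem sylvester_injective {R : Mat d} (hR : R.PosDef) : Function.Injective (sylvester R) := by
  rw [← LinearMap.ker_eq_bot, LinearMap.ker_eq_bot']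
  intro X hX
  rw [sylvester_apply] at hX
  have h1 : (Xᴴ * R * X).trace + (Xᴴᴴ * R * Xᴴ).trace = 0 := by
    have h2 := congrArg (fun Y => (Xᴴ * Y).trace) hX
    simp only [Matrix.mul_add, Matrix.trace_add, Matrix.mul_zero, Matrix.trace_zero] at h2
    rw [Matrix.conjTranspose_conjTranspose, Matrix.trace_mul_comm (X * R), Matrix.mul_assoc]
    exact h2
  have h3 := (hR.posSemidef.conjTranspose_mul_mul_same X).trace_nonneg
  have h4 := (hR.posSemidef.conjTranspose_mul_mul_same Xᴴ).trace_nonneg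
  exact eq_zero_of_trace_conj_eq_zero hR (by linarith)

noncomputable def sylvesterEquiv {R : Mat d} (hR : R.PosDef) : Mat d ≃L[ℝ] Mat d :=
  (LinearEquiv.ofInjectiveEndo (sylvester R) (sylvester_injective hR)).toContinuousLinearEquiv

theorem sylvesterEquiv_apply {R : Mat d} (hR : R.PosDef) (X : Mat d) :
    sylvesterEquiv hR X = R * X + X * R := rfl

theorem hasStrictFDerivAt_mul_self {R : Mat d} (hR : R.PosDef) :
    HasStrictFDerivAt (fun X : Mat d => X * X) (sylvesterEquiv hR : Mat d →L[ℝ] Mat d) R := by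
  have h := (hasStrictFDerivAt_id (𝕜 := ℝ) R).mul' (hasStrictFDerivAt_id (𝕜 := ℝ) R)
  refine HasStrictFDerivAt.congr_fderiv (f := fun X : Mat d => X * X) h ?_
  refine ContinuousLinearMap.ext fun X => ?_
  rfl

/-- The square root is differentiable along hermitian directions; its derivative solves a
Sylvester equation. -/
theorem exists_hasDerivAt_sqrt (hS : S.PosDef) {H : Mat d} (hH : H.IsHermitian) :
    ∃ L : Mat d, L.IsHermitian ∧ CFC.sqrt S * L + L * CFC.sqrt S = H ∧
      HasDerivAt (fun ε : ℝ => CFC.sqrt (S + ε • H)) L 0 := by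
  have hR := sqrt_posDef hS
  have hf := hasStrictFDerivAt_mul_self hR
  set g := hf.localInverse _ _ _
  have hg : HasStrictFDerivAt g ((sylvesterEquiv hR).symm : Mat d →L[ℝ] Mat d) S := by
    have := hf.to_localInverse
    rwa [sqrt_mul_sqrt hS.posSemidef] at this
  have hgS : g S = CFC.sqrt S := by
    have := hf.localInverse_apply_image
    rwa [sqrt_mul_sqrt hS.posSemidef] at this
  have hright : ∀ᶠ Y in 𝓝 S, g Y * g Y = Y := by
    have := hf.eventually_right_inverse
    rwa [sqrt_mul_sqrt hS.posSemidef] at this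
  have hleft : ∀ᶠ X in 𝓝 (CFC.sqrt S), g (X * X) = X := hf.eventually_left_inverse
  have htend : Filter.Tendsto g (𝓝 S) (𝓝 (CFC.sqrt S)) := by
    have := hg.continuousAt.tendsto
    rwa [hgS] at this
  have htend' : Filter.Tendsto (fun Y => (g Y)ᴴ) (𝓝 S) (𝓝 (CFC.sqrt S)) := by
    have := (continuous_id.matrix_conjTranspose.tendsto (CFC.sqrt S)).comp htend
    rwa [id, hR.1.eq] at this
  -- For hermitian `Y` near `S`, both `g Y` and its adjoint are roots of `Y` near `S^{1/2}`. Local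
  -- uniqueness makes `g Y` hermitian, nearness makes it positive definite, so it is the root.
  have hsqrt : ∀ᶠ Y in 𝓝 S, Y.IsHermitian → CFC.sqrt Y = g Y := by
    filter_upwards [hright, htend'.eventually hleft, htend.eventually (eventually_posDef hR)]
      with Y h1 h2 h3 hY
    have h4 : (g Y).IsHermitian := by
      rw [← Matrix.conjTranspose_mul, h1, hY.eq] at h2
      exact h2.symm
    rw [← sqrt_mul_self_eq (h3 h4).posSemidef, h1]
  have hline : HasDerivAt (fun ε : ℝ => S + ε • H) H 0 := by
    simpa using ((hasDerivAt_id (0 : ℝ)).smul_const H).const_add S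
  have hlim : Filter.Tendsto (fun ε : ℝ => S + ε • H) (𝓝 0) (𝓝 S) := by
    simpa using hline.continuousAt.tendsto
  have hderiv : HasDerivAt (fun ε : ℝ => g (S + ε • H)) ((sylvesterEquiv hR).symm H) 0 := by
    have hg0 : HasFDerivAt g ((sylvesterEquiv hR).symm : Mat d →L[ℝ] Mat d)
        (S + (0 : ℝ) • H) := by simpa using hg.hasFDerivAt
    exact hg0.comp_hasDerivAt (0 : ℝ) hline
  have hsol : CFC.sqrt S * (sylvesterEquiv hR).symm H + (sylvesterEquiv hR).symm H * CFC.sqrt S =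
      H := (sylvesterEquiv hR).apply_symm_apply H
  refine ⟨(sylvesterEquiv hR).symm H, ?_, hsol, ?_⟩
  · apply (sylvesterEquiv hR).injective
    rw [sylvesterEquiv_apply, sylvesterEquiv_apply, hsol]
    have := congrArg Matrix.conjTranspose hsol
    rw [Matrix.conjTranspose_add, Matrix.conjTranspose_mul, Matrix.conjTranspose_mul, hR.1.eq,
      hH.eq, add_comm] at this
    exact this
  · refine hderiv.congr_of_eventuallyEq ?_
    filter_upwards [hlim.eventually hsqrt] with ε hε
    exact hε (hS.1.add (hH.smul (IsSelfAdjoint.all ε)))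

end MatrixFacts

end BarycentricRisk

namespace BarycentricRisk

open scoped Matrix.Norms.L2Operator

/-! ### Derivatives of the location and scatter penalties. -/

section ScatterDerivative

variable {d n : ℕ} {S S' : Mat d}

theorem trace_of_sylvester {R L H : Mat d} (hR : R.PosDef) (h : R * L + L * R = H) :
    L.trace = 1 / 2 * (R⁻¹ * H).trace := by
  rw [← h, Matrix.mul_add, Matrix.trace_add, ← Matrix.mul_assoc, hR.inv_mul_self, Matrix.one_mul,
    Matrix.trace_mul_comm, Matrix.mul_assoc, hR.mul_inv_self, Matrix.mul_one]
  ring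

theorem hasDerivAt_trace_comp {f : ℝ → Mat d} {L : Mat d} {t : ℝ} (hf : HasDerivAt f L t) :
    HasDerivAt (fun s => (f s).trace) L.trace t :=
  (LinearMap.toContinuousLinearMap (Matrix.traceLinearMap (Fin d) ℝ ℝ)).hasFDerivAt.comp_hasDerivAt
    t hf

/-- Only the trace of the Sylvester solution matters, and it is explicit: `½ Tr(K^{-1/2} R' H R')`
with `R' = S'^{1/2}`, `K = R' S R'`. Cycling the factors produces `brenier S S'`. -/
theorem hasDerivAt_trace_sqrt_conj (hS : S.PosDef) (hS' : S'.PosDef) {H : Mat d}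
    (hH : H.IsHermitian) :
    HasDerivAt (fun ε : ℝ => (CFC.sqrt (CFC.sqrt S' * (S + ε • H) * CFC.sqrt S')).trace)
      (1 / 2 * (brenier S S' * H).trace) 0 := by
  have hR' := sqrt_posDef hS'
  have hK := posDef_conj hS hR'
  have hH' : (CFC.sqrt S' * H * CFC.sqrt S').IsHermitian := by
    have := Matrix.isHermitian_mul_mul_conjTranspose (CFC.sqrt S') hH
    rwa [hR'.1.eq] at this
  obtain ⟨L, -, hL, hd⟩ := exists_hasDerivAt_sqrt hK hH'
  have h1 := hasDerivAt_trace_comp hd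
  rw [trace_of_sylvester (sqrt_posDef hK) hL] at h1
  have h2 : ((CFC.sqrt (CFC.sqrt S' * S * CFC.sqrt S'))⁻¹ * (CFC.sqrt S' * H * CFC.sqrt S')).trace =
      (brenier S S' * H).trace := by
    have h3 : ∀ R K : Mat d, (K * (R * H * R)).trace = (R * K * R * H).trace := fun R K => by
      rw [Matrix.mul_assoc (R * K), Matrix.mul_assoc R K, Matrix.trace_mul_comm R]
      simp only [Matrix.mul_assoc]
    exact h3 _ _
  rw [h2] at h1
  convert h1 using 5
  simp [Matrix.mul_add, Matrix.add_mul]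

theorem hasDerivAt_scatFrechet (w : Fin n → ℝ) {Ss : Fin n → Mat d} (hSs : ∀ i, (Ss i).PosDef)
    (hS : S.PosDef) {H : Mat d} (hH : H.IsHermitian) :
    HasDerivAt (fun ε : ℝ => scatFrechet w Ss (S + ε • H))
      (∑ i, w i * (H.trace - (brenier S (Ss i) * H).trace)) 0 := by
  unfold scatFrechet
  refine HasDerivAt.fun_sum fun i _ => HasDerivAt.const_mul _ ?_
  have hline : HasDerivAt (fun ε : ℝ => S + ε • H) H 0 := by
    simpa using ((hasDerivAt_id (0 : ℝ)).smul_const H).const_add S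
  have h1 := ((hasDerivAt_trace_comp hline).add_const (Ss i).trace).sub
    ((hasDerivAt_trace_sqrt_conj hS (hSs i) hH).const_mul 2)
  have h2 : H.trace - 2 * (1 / 2 * (brenier S (Ss i) * H).trace) =
      H.trace - (brenier S (Ss i) * H).trace := by ring
  rw [h2] at h1
  refine h1.congr_of_eventuallyEq (Filter.Eventually.of_forall fun ε => ?_)
  simp only [Matrix.trace_add, Matrix.trace_sub, Matrix.trace_smul, smul_eq_mul, Pi.sub_apply]

theorem hasDerivAt_locFrechet (w : Fin n → ℝ) (hw : ∑ i, w i = 1) (ms : Fin n → Vec d)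
    (m h : Vec d) :
    HasDerivAt (fun ε : ℝ => locFrechet w ms (m + ε • h))
      (2 * inner ℝ (m - meanBary w ms) h) 0 := by
  unfold locFrechet
  have hline : HasDerivAt (fun ε : ℝ => m + ε • h) h 0 := by
    simpa using ((hasDerivAt_id (0 : ℝ)).smul_const h).const_add m
  have h1 : HasDerivAt (fun ε : ℝ => ∑ i, w i * ‖m + ε • h - ms i‖ ^ 2)
      (∑ i, w i * (2 * inner ℝ (m - ms i) h)) 0 := by
    refine HasDerivAt.fun_sum fun i _ => HasDerivAt.const_mul _ ?_
    simpa using (hline.sub_const (ms i)).norm_sq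
  convert h1 using 1
  have h2 : m - meanBary w ms = ∑ i, w i • (m - ms i) := by
    simp only [smul_sub, Finset.sum_sub_distrib, ← Finset.sum_smul, hw, one_smul, meanBary]
  rw [h2, sum_inner, Finset.mul_sum]
  refine Finset.sum_congr rfl fun i _ => ?_
  rw [real_inner_smul_left]
  ring

/-- Expanding around the barycentre, the cross term vanishes because the weighted deviations sum to
zero. Hence the barycentre minimizes the location part. -/
theorem locFrechet_sub (w : Fin n → ℝ) (hw : ∑ i, w i = 1) (ms : Fin n → Vec d) (m : Vec d) :
    locFrechet w ms m - locFrechet w ms (meanBary w ms) = ‖m - meanBary w ms‖ ^ 2 := by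
  set b := meanBary w ms with hb
  have h1 : ∀ i, ‖m - ms i‖ ^ 2 = ‖m - b‖ ^ 2 + 2 * inner ℝ (m - b) (b - ms i) +
      ‖b - ms i‖ ^ 2 := fun i => by
    rw [← norm_add_sq_real, sub_add_sub_cancel]
  have h2 : ∑ i, w i * inner ℝ (m - b) (b - ms i) = 0 := by
    have h3 : ∑ i, w i • (b - ms i) = 0 := by
      simp only [smul_sub, Finset.sum_sub_distrib, ← Finset.sum_smul, hw, one_smul]
      rw [hb, meanBary, sub_self]
    simp only [← real_inner_smul_right]
    rw [← inner_sum, h3, inner_zero_right]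
  unfold locFrechet
  simp only [h1, mul_add, Finset.sum_add_distrib]
  rw [← Finset.sum_mul, hw]
  have h4 : ∑ i, w i * (2 * inner ℝ (m - b) (b - ms i)) = 0 := by
    simp only [mul_left_comm _ (2 : ℝ)]
    rw [← Finset.mul_sum, h2, mul_zero]
  rw [h4]
  ring

end ScatterDerivative

end BarycentricRisk

namespace BarycentricRisk

/-! ### First and second moments, and integrals of quadratic functions. -/

section Moments

variable {d : ℕ}

/-- `μ` is square integrable with mean `m` and covariance matrix `C`. -/
structure HasMoments (μ : Measure (Vec d)) (m : Vec d) (C : Mat d) : Prop where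
  memLp : MemLp (fun x : Vec d => x) 2 μ
  mean : ∫ x, x ∂μ = m
  cov : ∀ k l, ∫ x, (x - m) k * (x - m) l ∂μ = C k l

theorem IsCentralLaw.hasMoments {ν : ProbabilityMeasure (Vec d)} (hν : IsCentralLaw ν) :
    HasMoments (ν : Measure (Vec d)) 0 1 where
  memLp := hν.memLp
  mean := hν.mean
  cov := by simpa using hν.cov

theorem inner_toEuclideanCLM_eq_sum (A : Mat d) (x : Vec d) :
    inner ℝ x (Matrix.toEuclideanCLM (𝕜 := ℝ) A x) = ∑ k, ∑ l, A k l * (x k * x l) := by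
  rw [Matrix.inner_toEuclideanCLM]
  simp only [dotProduct, Matrix.mulVec, Finset.mul_sum]
  exact Finset.sum_congr rfl fun k _ => Finset.sum_congr rfl fun l _ => by ring

theorem toEuclideanCLM_mul_apply (A B : Mat d) (x : Vec d) :
    Matrix.toEuclideanCLM (𝕜 := ℝ) (A * B) x =
      Matrix.toEuclideanCLM (𝕜 := ℝ) A (Matrix.toEuclideanCLM (𝕜 := ℝ) B x) := by
  rw [map_mul]; rfl

theorem inner_toEuclideanCLM_left (A : Mat d) (x y : Vec d) :
    inner ℝ (Matrix.toEuclideanCLM (𝕜 := ℝ) A x) y =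
      inner ℝ x (Matrix.toEuclideanCLM (𝕜 := ℝ) Aᵀ y) := by
  rw [real_inner_comm, Matrix.inner_toEuclideanCLM, Matrix.inner_toEuclideanCLM,
    Matrix.dotProduct_mulVec, ← Matrix.mulVec_transpose, dotProduct_comm]

theorem _root_.MeasureTheory.MemLp.coord {Ω : Type*} [MeasurableSpace Ω] {μ : Measure Ω}
    {f : Ω → Vec d} (hf : MemLp f 2 μ) (k : Fin d) : MemLp (fun x => f x k) 2 μ :=
  (EuclideanSpace.proj (𝕜 := ℝ) k).comp_memLp' hf

namespace HasMoments

variable {μ : Measure (Vec d)} {m : Vec d} {C : Mat d}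

theorem cov_comm (h : HasMoments μ m C) (k l : Fin d) : C k l = C l k := by
  rw [← h.cov, ← h.cov]
  simp only [mul_comm]

/-- Any square integrable law has moments. -/
theorem of_memLp (h : MemLp (fun x : Vec d => x) 2 μ) : ∃ m C, HasMoments μ m C :=
  ⟨∫ x, x ∂μ, Matrix.of fun k l => ∫ x, (x - ∫ y, y ∂μ) k * (x - ∫ y, y ∂μ) l ∂μ,
    h, rfl, fun _ _ => rfl⟩

variable [IsProbabilityMeasure μ]

theorem memLp_sub (h : HasMoments μ m C) : MemLp (fun x : Vec d => x - m) 2 μ :=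
  h.memLp.sub (memLp_const m)

theorem integrable (h : HasMoments μ m C) : Integrable (fun x : Vec d => x) μ :=
  h.memLp.integrable (by norm_num)

theorem integrable_sub (h : HasMoments μ m C) : Integrable (fun x : Vec d => x - m) μ :=
  h.memLp_sub.integrable (by norm_num)

theorem integral_sub_mean (h : HasMoments μ m C) : ∫ x, (x - m) ∂μ = 0 := by
  rw [integral_sub h.integrable (integrable_const m), h.mean]
  simp

theorem integrable_mul (h : HasMoments μ m C) (k l : Fin d) :
    Integrable (fun x : Vec d => (x - m) k * (x - m) l) μ :=
  (h.memLp_sub.coord k).integrable_mul (h.memLp_sub.coord l)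

theorem integrable_quadratic (h : HasMoments μ m C) (A : Mat d) :
    Integrable (fun x : Vec d => inner ℝ (x - m)
      (Matrix.toEuclideanCLM (𝕜 := ℝ) A (x - m))) μ := by
  simp only [inner_toEuclideanCLM_eq_sum]
  exact integrable_finsetSum _ fun k _ => integrable_finsetSum _ fun l _ =>
    (h.integrable_mul k l).const_mul _

theorem integral_quadratic (h : HasMoments μ m C) (A : Mat d) :
    ∫ x, inner ℝ (x - m) (Matrix.toEuclideanCLM (𝕜 := ℝ) A (x - m)) ∂μ = (A * C).trace := by
  simp only [inner_toEuclideanCLM_eq_sum]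
  have hi : ∀ k l, Integrable (fun x : Vec d => A k l * ((x - m) k * (x - m) l)) μ :=
    fun k l => (h.integrable_mul k l).const_mul _
  calc _ = ∑ k, ∑ l, ∫ x, A k l * ((x - m) k * (x - m) l) ∂μ := by
        rw [integral_finsetSum Finset.univ
          (f := fun k (x : Vec d) => ∑ l, A k l * ((x - m) k * (x - m) l))
          fun k _ => integrable_finsetSum _ fun l _ => hi k l]
        exact Finset.sum_congr rfl fun k _ => integral_finsetSum _ fun l _ => hi k l
    _ = (A * C).trace := by
        simp only [Matrix.trace, Matrix.diag, Matrix.mul_apply]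
        refine Finset.sum_congr rfl fun k _ => Finset.sum_congr rfl fun l _ => ?_
        rw [integral_const_mul, h.cov, h.cov_comm]

theorem integral_inner_sub (h : HasMoments μ m C) (a : Vec d) :
    ∫ x, inner ℝ a (x - m) ∂μ = 0 := by
  rw [integral_inner h.integrable_sub, h.integral_sub_mean, inner_zero_right]

theorem integrable_inner_sub (h : HasMoments μ m C) (a : Vec d) :
    Integrable (fun x => inner ℝ a (x - m)) μ :=
  h.integrable_sub.const_inner a

theorem integrable_affine_quadratic (h : HasMoments μ m C) (c : ℝ) (a : Vec d) (A : Mat d) :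
    Integrable (fun x : Vec d => c + 2 * inner ℝ a (x - m) +
      inner ℝ (x - m) (Matrix.toEuclideanCLM (𝕜 := ℝ) A (x - m))) μ :=
  ((integrable_const c).add ((h.integrable_inner_sub a).const_mul 2)).add (h.integrable_quadratic A)

/-- Dual potentials and the cost of an affine map both have this shape; centring removes the linear
term. -/
theorem integral_affine_quadratic (h : HasMoments μ m C) (c : ℝ) (a : Vec d) (A : Mat d) :
    ∫ x, (c + 2 * inner ℝ a (x - m) +
      inner ℝ (x - m) (Matrix.toEuclideanCLM (𝕜 := ℝ) A (x - m))) ∂μ = c + (A * C).trace := by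
  have h1 : Integrable (fun x : Vec d => c + 2 * inner ℝ a (x - m)) μ :=
    (integrable_const c).add ((h.integrable_inner_sub a).const_mul 2)
  rw [integral_add h1 (h.integrable_quadratic A), h.integral_quadratic,
    integral_add (integrable_const c) ((h.integrable_inner_sub a).const_mul 2),
    integral_const_mul, h.integral_inner_sub]
  simp

/-- Moments of an affine image. -/
theorem map_affine (h : HasMoments μ 0 C) (a : Vec d) (B : Mat d) :
    HasMoments (μ.map fun z => a + Matrix.toEuclideanCLM (𝕜 := ℝ) B z) a (B * C * Bᵀ) := by
  have hc : Continuous fun z : Vec d => a + Matrix.toEuclideanCLM (𝕜 := ℝ) B z := by fun_prop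
  have hB : MemLp (fun z : Vec d => Matrix.toEuclideanCLM (𝕜 := ℝ) B z) 2 μ :=
    (Matrix.toEuclideanCLM (𝕜 := ℝ) B).comp_memLp' h.memLp
  refine ⟨?_, ?_, fun k l => ?_⟩
  · rw [memLp_map_measure_iff (by fun_prop) hc.measurable.aemeasurable]
    exact (memLp_const a).add hB
  · rw [integral_map hc.measurable.aemeasurable (by fun_prop),
      integral_add (integrable_const a) (hB.integrable (by norm_num)),
      ContinuousLinearMap.integral_comp_comm _ h.integrable, h.mean]
    simp
  · rw [integral_map hc.measurable.aemeasurable (by fun_prop)]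
    simp only [add_sub_cancel_left, Matrix.ofLp_toEuclideanCLM, Matrix.mulVec, dotProduct,
      Finset.sum_mul_sum]
    have hi : ∀ i j, Integrable (fun z : Vec d => B k i * z i * (B l j * z j)) μ := fun i j => by
      have := (h.integrable_mul i j).const_mul (B k i * B l j)
      simp only [sub_zero] at this
      exact this.congr (Filter.Eventually.of_forall fun z => by simp only; ring)
    rw [integral_finsetSum _ fun i _ => integrable_finsetSum _ fun j _ => hi i j]
    simp only [Matrix.mul_apply, Matrix.transpose_apply, Finset.sum_mul]
    rw [Finset.sum_comm]
    refine Finset.sum_congr rfl fun i _ => ?_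
    rw [integral_finsetSum _ fun j _ => hi i j]
    refine Finset.sum_congr rfl fun j _ => ?_
    have := h.cov i j
    simp only [sub_zero] at this
    rw [← this, mul_assoc, mul_comm _ (B l j), ← mul_assoc, ← integral_const_mul]
    exact integral_congr_ae (Filter.Eventually.of_forall fun z => by simp only; ring)

end HasMoments

theorem LS_hasMoments {ν : ProbabilityMeasure (Vec d)} (hν : IsCentralLaw ν) (m : Vec d)
    {S : Mat d} (hS : S.PosDef) : HasMoments (LS ν m S : Measure (Vec d)) m S := by
  have h := hν.hasMoments.map_affine m (CFC.sqrt S)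
  rw [Matrix.mul_one, ← Matrix.conjTranspose_eq_transpose_of_trivial, (sqrt_posDef hS).1.eq,
    sqrt_mul_sqrt hS.posSemidef] at h
  exact h

end Moments

end BarycentricRisk

namespace BarycentricRisk

/-! ### Lower and upper bounds for the Wasserstein distance. -/

section Wasserstein

variable {d n : ℕ}

theorem W2_sq (μ μ' : ProbabilityMeasure (Vec d)) :
    W2 μ μ' ^ 2 = ⨅ π ∈ transportPlans μ μ', ∫⁻ p, edist p.1 p.2 ^ 2 ∂π := by
  rw [W2, ← ENNReal.rpow_natCast, ← ENNReal.rpow_mul]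
  norm_num

theorem edist_sq_eq_ofReal (x y : Vec d) : edist x y ^ 2 = ENNReal.ofReal (‖x - y‖ ^ 2) := by
  rw [edist_dist, dist_eq_norm, ENNReal.ofReal_pow (norm_nonneg _)]

/-- Young's inequality for a positive definite matrix. -/
theorem two_inner_le_quadratic {T : Mat d} (hT : T.PosDef) (u v : Vec d) :
    2 * inner ℝ u v ≤ inner ℝ u (Matrix.toEuclideanCLM (𝕜 := ℝ) T u) +
      inner ℝ v (Matrix.toEuclideanCLM (𝕜 := ℝ) T⁻¹ v) := by
  set R := CFC.sqrt T
  have hR : R.PosDef := sqrt_posDef hT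
  have hRR : R * R = T := sqrt_mul_sqrt hT.posSemidef
  have hRt : Rᵀ = R := by rw [← Matrix.conjTranspose_eq_transpose_of_trivial, hR.1.eq]
  have hRit : R⁻¹ᵀ = R⁻¹ := by rw [← Matrix.conjTranspose_eq_transpose_of_trivial, hR.inv.1.eq]
  have h1 : inner ℝ u (Matrix.toEuclideanCLM (𝕜 := ℝ) T u) =
      ‖Matrix.toEuclideanCLM (𝕜 := ℝ) R u‖ ^ 2 := by
    rw [← real_inner_self_eq_norm_sq, inner_toEuclideanCLM_left, hRt, ← toEuclideanCLM_mul_apply,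
      hRR]
  have h2 : inner ℝ v (Matrix.toEuclideanCLM (𝕜 := ℝ) T⁻¹ v) =
      ‖Matrix.toEuclideanCLM (𝕜 := ℝ) R⁻¹ v‖ ^ 2 := by
    rw [← real_inner_self_eq_norm_sq, inner_toEuclideanCLM_left, hRit, ← toEuclideanCLM_mul_apply,
      ← Matrix.mul_inv_rev, hRR]
  have h3 : inner ℝ (Matrix.toEuclideanCLM (𝕜 := ℝ) R u) (Matrix.toEuclideanCLM (𝕜 := ℝ) R⁻¹ v) =
      inner ℝ u v := by
    rw [inner_toEuclideanCLM_left, hRt, ← toEuclideanCLM_mul_apply, hR.mul_inv_self, map_one]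
    rfl
  rw [h1, h2, ← h3]
  have h4 := norm_sub_sq_real (Matrix.toEuclideanCLM (𝕜 := ℝ) R u)
    (Matrix.toEuclideanCLM (𝕜 := ℝ) R⁻¹ v)
  nlinarith [sq_nonneg ‖Matrix.toEuclideanCLM (𝕜 := ℝ) R u - Matrix.toEuclideanCLM (𝕜 := ℝ) R⁻¹ v‖]

theorem ofReal_integral_le_lintegral {Ω : Type*} [MeasurableSpace Ω] {μ : Measure Ω} {f : Ω → ℝ}
    (hf : Integrable f μ) : ENNReal.ofReal (∫ x, f x ∂μ) ≤ ∫⁻ x, ENNReal.ofReal (f x) ∂μ := by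
  rw [integral_eq_lintegral_pos_part_sub_lintegral_neg_part hf]
  exact (ENNReal.ofReal_le_ofReal (sub_le_self _ ENNReal.toReal_nonneg)).trans
    ENNReal.ofReal_toReal_le

/-- The dual form of Gelbrich's lower bound. -/
theorem gelbrich_le_W2_sq {μ μ' : ProbabilityMeasure (Vec d)} {m m' : Vec d} {C C' : Mat d}
    (h : HasMoments (μ : Measure (Vec d)) m C) (h' : HasMoments (μ' : Measure (Vec d)) m' C')
    {T : Mat d} (hT : T.PosDef) :
    ENNReal.ofReal (‖m - m'‖ ^ 2 + C.trace + C'.trace - (T * C).trace - (T⁻¹ * C').trace) ≤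
      W2 μ μ' ^ 2 := by
  rw [W2_sq]
  refine le_iInf₂ fun π hπ => ?_
  obtain ⟨h1, h2⟩ := hπ
  have hp1 : MeasurePreserving Prod.fst π (μ : Measure (Vec d)) := ⟨measurable_fst, h1⟩
  have hp2 : MeasurePreserving Prod.snd π (μ' : Measure (Vec d)) := ⟨measurable_snd, h2⟩
  have hprob : IsProbabilityMeasure π := ⟨by
    rw [← Measure.fst_univ, h1, measure_univ]⟩
  -- Dual potentials: expand `‖x - y‖²` around the means, with `u = x - m` and `v = y - m'`, and
  -- replace `-2⟨u, v⟩` by its Young lower bound, which separates the variables. The constant is all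
  -- in `f`.
  set f : Vec d → ℝ := fun x => ‖m - m'‖ ^ 2 + 2 * inner ℝ (m - m') (x - m) +
    inner ℝ (x - m) (Matrix.toEuclideanCLM (𝕜 := ℝ) (1 - T) (x - m)) with hf
  set g : Vec d → ℝ := fun y => 0 + 2 * inner ℝ (-(m - m')) (y - m') +
    inner ℝ (y - m') (Matrix.toEuclideanCLM (𝕜 := ℝ) (1 - T⁻¹) (y - m')) with hg
  have hfi : Integrable f (μ : Measure (Vec d)) := h.integrable_affine_quadratic _ _ _
  have hgi : Integrable g (μ' : Measure (Vec d)) := h'.integrable_affine_quadratic _ _ _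
  have hfv : ∫ x, f x ∂(μ : Measure (Vec d)) = ‖m - m'‖ ^ 2 + ((1 - T) * C).trace :=
    h.integral_affine_quadratic _ _ _
  have hgv : ∫ x, g x ∂(μ' : Measure (Vec d)) = 0 + ((1 - T⁻¹) * C').trace :=
    h'.integral_affine_quadratic _ _ _
  have hfi' : Integrable (fun p : Vec d × Vec d => f p.1) π := hp1.integrable_comp_of_integrable hfi
  have hgi' : Integrable (fun p : Vec d × Vec d => g p.2) π := hp2.integrable_comp_of_integrable hgi
  have hfv' : ∫ p, f p.1 ∂π = ‖m - m'‖ ^ 2 + ((1 - T) * C).trace := by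
    rw [← hfv, ← hp1.map_eq, integral_map hp1.measurable.aemeasurable]
    rw [hp1.map_eq]; exact hfi.aestronglyMeasurable
  have hgv' : ∫ p, g p.2 ∂π = 0 + ((1 - T⁻¹) * C').trace := by
    rw [← hgv, ← hp2.map_eq, integral_map hp2.measurable.aemeasurable]
    rw [hp2.map_eq]; exact hgi.aestronglyMeasurable
  have hpt : ∀ p : Vec d × Vec d, f p.1 + g p.2 ≤ ‖p.1 - p.2‖ ^ 2 := fun p => by
    have e1 : p.1 - p.2 = (m - m') + ((p.1 - m) - (p.2 - m')) := by abel
    have e2 := two_inner_le_quadratic hT (p.1 - m) (p.2 - m')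
    have e3 : ∀ (A : Mat d) (x : Vec d), inner ℝ x (Matrix.toEuclideanCLM (𝕜 := ℝ) (1 - A) x) =
        ‖x‖ ^ 2 - inner ℝ x (Matrix.toEuclideanCLM (𝕜 := ℝ) A x) := fun A x => by
      rw [map_sub, map_one, _root_.sub_apply, inner_sub_right, ← real_inner_self_eq_norm_sq]
      rfl
    rw [e1, norm_add_sq_real (m - m'), norm_sub_sq_real (p.1 - m), inner_sub_right (m - m')]
    simp only [hf, hg, e3, inner_neg_left]
    linarith
  calc _ = ENNReal.ofReal (∫ p, (f p.1 + g p.2) ∂π) := by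
        rw [integral_add hfi' hgi', hfv', hgv']
        congr 1
        simp only [Matrix.sub_mul, Matrix.one_mul, Matrix.trace_sub]
        ring
    _ ≤ ∫⁻ p, ENNReal.ofReal (f p.1 + g p.2) ∂π := ofReal_integral_le_lintegral (hfi'.add hgi')
    _ ≤ _ := lintegral_mono fun p => by
        rw [edist_sq_eq_ofReal]; exact ENNReal.ofReal_le_ofReal (hpt p)

/-- The left side is the transport cost of the centred linear map `x ↦ T x` for covariance `S`.
Being the trace of a congruence of `S`, it also shows that the Bures term is nonnegative. -/
theorem trace_one_sub_brenier_conj {S S' : Mat d} (hS : S.PosDef) (hS' : S'.PosDef) :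
    ((1 - brenier S S') * S * (1 - brenier S S')).trace =
      (S + S' - (2 : ℝ) • CFC.sqrt (CFC.sqrt S' * S * CFC.sqrt S')).trace := by
  have e1 : (1 - brenier S S') * S * (1 - brenier S S') =
      S - brenier S S' * S - S * brenier S S' + brenier S S' * S * brenier S S' := by
    noncomm_ring
  rw [e1, brenier_mul_mul_brenier hS hS']
  simp only [Matrix.trace_add, Matrix.trace_sub, Matrix.trace_smul, smul_eq_mul]
  rw [Matrix.trace_mul_comm S, trace_brenier_mul hS hS']
  ring

theorem bures_nonneg {S S' : Mat d} (hS : S.PosDef) (hS' : S'.PosDef) :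
    0 ≤ (S + S' - (2 : ℝ) • CFC.sqrt (CFC.sqrt S' * S * CFC.sqrt S')).trace := by
  rw [← trace_one_sub_brenier_conj hS hS']
  have h := hS.posSemidef.conjTranspose_mul_mul_same (1 - brenier S S')
  rw [Matrix.conjTranspose_sub, Matrix.conjTranspose_one, (brenier_posDef hS hS').1.eq] at h
  exact h.trace_nonneg

/-- The Wasserstein distance within a location-scatter family is at most the cost of the
optimal affine map. -/
theorem W2_sq_LS_le {ν : ProbabilityMeasure (Vec d)} (hν : IsCentralLaw ν) (m m' : Vec d)
    {S S' : Mat d} (hS : S.PosDef) (hS' : S'.PosDef) :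
    W2 (LS ν m S) (LS ν m' S') ^ 2 ≤ ENNReal.ofReal (‖m - m'‖ ^ 2 +
      (S + S' - (2 : ℝ) • CFC.sqrt (CFC.sqrt S' * S * CFC.sqrt S')).trace) := by
  obtain ⟨U, hU, hTU⟩ := exists_rotation_brenier_mul_sqrt hS hS'
  set T := brenier S S'
  have hT : T.PosDef := brenier_posDef hS hS'
  set Y : Vec d → Vec d := fun z => m' + Matrix.toEuclideanCLM (𝕜 := ℝ) (T * CFC.sqrt S) z with hY
  have hYc : Continuous Y := by rw [hY]; fun_prop
  have hX := continuous_lsMap m S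
  have hYl : (ν : Measure (Vec d)).map Y = (LS ν m' S' : Measure (Vec d)) := by
    -- The polar decomposition moves the rotation next to `z`, where it leaves `ν` unchanged.
    have h1 : Y = lsMap m' S' ∘ Matrix.toEuclideanCLM (𝕜 := ℝ) U := by
      ext1 z
      simp only [hY, hTU, toEuclideanCLM_mul_apply, lsMap, Function.comp_apply]
    rw [h1, ← Measure.map_map (continuous_lsMap m' S').measurable (by fun_prop), hν.rotation U hU]
    rfl
  have hplan : (ν : Measure (Vec d)).map (fun z => (lsMap m S z, Y z)) ∈
      transportPlans (LS ν m S) (LS ν m' S') := by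
    refine ⟨?_, ?_⟩
    · rw [Measure.fst_map_prodMk hYc.measurable]; rfl
    · rw [Measure.snd_map_prodMk hX.measurable, hYl]
  rw [W2_sq]
  refine (iInf₂_le _ hplan).trans_eq ?_
  rw [lintegral_map (by fun_prop) (by fun_prop)]
  simp only [edist_sq_eq_ofReal]
  set B : Mat d := (1 - T) * CFC.sqrt S
  have hR := sqrt_posDef hS
  -- The terms `z - 0` match `integral_affine_quadratic` for the mean zero law `ν`.
  have hd : ∀ z, ‖lsMap m S z - Y z‖ ^ 2 = ‖m - m'‖ ^ 2 + 2 *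
      inner ℝ (Matrix.toEuclideanCLM (𝕜 := ℝ) Bᵀ (m - m')) (z - 0) +
      inner ℝ (z - 0) (Matrix.toEuclideanCLM (𝕜 := ℝ) (Bᵀ * B) (z - 0)) := fun z => by
    have e1 : lsMap m S z - Y z = (m - m') + Matrix.toEuclideanCLM (𝕜 := ℝ) B z := by
      simp only [hY, lsMap, B, Matrix.sub_mul, Matrix.one_mul, map_sub,
        _root_.sub_apply]
      abel
    rw [e1, norm_add_sq_real, sub_zero, inner_toEuclideanCLM_left, Matrix.transpose_transpose,
      toEuclideanCLM_mul_apply Bᵀ B z]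
    congr 1
    rw [← real_inner_self_eq_norm_sq, inner_toEuclideanCLM_left]
  have hm := hν.hasMoments
  have htr : (Bᵀ * B).trace =
      (S + S' - (2 : ℝ) • CFC.sqrt (CFC.sqrt S' * S * CFC.sqrt S')).trace := by
    have hBt : Bᵀ = CFC.sqrt S * (1 - T) := by
      rw [← Matrix.conjTranspose_eq_transpose_of_trivial, Matrix.conjTranspose_mul, hR.1.eq,
        Matrix.conjTranspose_sub, hT.1.eq, Matrix.conjTranspose_one]
    rw [← trace_one_sub_brenier_conj hS hS', Matrix.trace_mul_comm, hBt]
    simp only [B, Matrix.mul_assoc]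
    rw [← Matrix.mul_assoc (CFC.sqrt S), sqrt_mul_sqrt hS.posSemidef]
  rw [← ofReal_integral_eq_lintegral_ofReal]
  · congr 1
    simp only [hd]
    rw [hm.integral_affine_quadratic, Matrix.mul_one, htr]
  · simp only [hd]
    exact hm.integrable_affine_quadratic _ _ _
  · exact Filter.Eventually.of_forall fun z => by positivity

end Wasserstein

end BarycentricRisk

namespace BarycentricRisk

/-! ### The Fréchet variance and the reduction to the matrix problem. -/

section RiskMeasure

variable {d n : ℕ}

/-- The Wasserstein distance within a location-scatter family. -/
theorem W2_sq_LS {ν : ProbabilityMeasure (Vec d)} (hν : IsCentralLaw ν) (m m' : Vec d)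
    {S S' : Mat d} (hS : S.PosDef) (hS' : S'.PosDef) :
    W2 (LS ν m S) (LS ν m' S') ^ 2 = ENNReal.ofReal (‖m - m'‖ ^ 2 +
      (S + S' - (2 : ℝ) • CFC.sqrt (CFC.sqrt S' * S * CFC.sqrt S')).trace) := by
  refine (W2_sq_LS_le hν m m' hS hS').antisymm ?_
  refine le_trans (ENNReal.ofReal_le_ofReal (le_of_eq ?_))
    (gelbrich_le_W2_sq (LS_hasMoments hν m hS) (LS_hasMoments hν m' hS') (brenier_posDef hS hS'))
  rw [trace_brenier_mul hS hS', trace_inv_brenier_mul hS hS']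
  simp only [Matrix.trace_add, Matrix.trace_sub, Matrix.trace_smul, smul_eq_mul]
  ring

theorem sum_ofReal_mul_ofReal {w a : Fin n → ℝ} (hw : ∀ i, 0 ≤ w i) (ha : ∀ i, 0 ≤ a i) :
    ∑ i, ENNReal.ofReal (w i) * ENNReal.ofReal (a i) = ENNReal.ofReal (∑ i, w i * a i) := by
  rw [ENNReal.ofReal_sum_of_nonneg fun i _ => mul_nonneg (hw i) (ha i)]
  exact Finset.sum_congr rfl fun i _ => (ENNReal.ofReal_mul (hw i)).symm

/-- No sign is imposed on `a`, since the regularized lower bounds below may be negative. -/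
theorem ofReal_sum_le_sum_ofReal_mul_ofReal {w a : Fin n → ℝ} (hw : ∀ i, 0 ≤ w i) :
    ENNReal.ofReal (∑ i, w i * a i) ≤ ∑ i, ENNReal.ofReal (w i) * ENNReal.ofReal (a i) := by
  have h : ∀ i, ENNReal.ofReal (a i) = ENNReal.ofReal (max (a i) 0) := fun i => by
    rcases le_total (a i) 0 with h | h
    · rw [max_eq_right h, ENNReal.ofReal_of_nonpos h, ENNReal.ofReal_zero]
    · rw [max_eq_left h]
  simp only [h]
  rw [sum_ofReal_mul_ofReal hw fun i => le_max_right _ _]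
  exact ENNReal.ofReal_le_ofReal
    (Finset.sum_le_sum fun i _ => mul_le_mul_of_nonneg_left (le_max_left _ _) (hw i))

theorem locFrechet_nonneg {w : Fin n → ℝ} (hw : ∀ i, 0 ≤ w i) (ms : Fin n → Vec d) (m : Vec d) :
    0 ≤ locFrechet w ms m :=
  Finset.sum_nonneg fun i _ => mul_nonneg (hw i) (sq_nonneg _)

variable {w : Fin n → ℝ} {Ss : Fin n → Mat d} {S : Mat d}

theorem scatFrechet_nonneg (hw : ∀ i, 0 ≤ w i) (hSs : ∀ i, (Ss i).PosDef) (hS : S.PosDef) :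
    0 ≤ scatFrechet w Ss S :=
  Finset.sum_nonneg fun i _ => mul_nonneg (hw i) (bures_nonneg hS (hSs i))

theorem scatVar_nonneg (hw : ∀ i, 0 ≤ w i) (hSs : ∀ i, (Ss i).PosDef) : 0 ≤ scatVar w Ss :=
  Real.iInf_nonneg fun S => scatFrechet_nonneg hw hSs S.2

theorem scatVar_le (hw : ∀ i, 0 ≤ w i) (hSs : ∀ i, (Ss i).PosDef) (hS : S.PosDef) :
    scatVar w Ss ≤ scatFrechet w Ss S :=
  ciInf_le (f := fun S : {S : Mat d // S.PosDef} => scatFrechet w Ss S.1)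
    ⟨0, by rintro _ ⟨S, rfl⟩; exact scatFrechet_nonneg hw hSs S.2⟩ ⟨S, hS⟩

theorem frechetFun_LS {ν : ProbabilityMeasure (Vec d)} (hν : IsCentralLaw ν)
    (hw : ∀ i, 0 ≤ w i) (ms : Fin n → Vec d) (hSs : ∀ i, (Ss i).PosDef) (m : Vec d)
    (hS : S.PosDef) :
    frechetFun w (fun i => LS ν (ms i) (Ss i)) (LS ν m S) =
      ENNReal.ofReal (locFrechet w ms m + scatFrechet w Ss S) := by
  unfold frechetFun
  simp only [W2_sq_LS hν m _ hS (hSs _)]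
  rw [sum_ofReal_mul_ofReal hw fun i => add_nonneg (sq_nonneg _) (bures_nonneg hS (hSs i))]
  simp only [mul_add, Finset.sum_add_distrib, locFrechet, scatFrechet]

/-- The form `⟨x, C x⟩` is the integral of `⟨x, y - m⟩²`, obtained from the rank one matrix `x xᵀ`.
-/
theorem HasMoments.posSemidef {μ : Measure (Vec d)} [IsProbabilityMeasure μ] {m : Vec d}
    {C : Mat d} (h : HasMoments μ m C) : C.PosSemidef := by
  refine Matrix.PosSemidef.of_dotProduct_mulVec_nonneg ?_ fun x => ?_
  · ext k l
    exact h.cov_comm l k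
  · have h1 := h.integral_quadratic (Matrix.vecMulVec x x)
    have h2 : star x ⬝ᵥ C *ᵥ x = (Matrix.vecMulVec x x * C).trace := by
      rw [Matrix.trace_mul_comm, Matrix.mul_vecMulVec, Matrix.trace_vecMulVec, star_trivial,
        dotProduct_comm]
    rw [h2, ← h1]
    refine integral_nonneg fun y => ?_
    rw [inner_toEuclideanCLM_eq_sum]
    have h3 : ∑ k, ∑ l, Matrix.vecMulVec x x k l * ((y - m) k * (y - m) l) =
        (∑ k, x k * (y - m) k) ^ 2 := by
      rw [sq, Finset.sum_mul_sum]
      refine Finset.sum_congr rfl fun k _ => Finset.sum_congr rfl fun l _ => ?_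
      rw [Matrix.vecMulVec_apply]
      ring
    rw [h3]
    exact sq_nonneg _

/-- A law at finite Wasserstein distance from a square integrable law is square integrable. -/
theorem memLp_of_W2_ne_top {μ μ' : ProbabilityMeasure (Vec d)}
    (h' : MemLp (fun x : Vec d => x) 2 (μ' : Measure (Vec d))) (h : W2 μ μ' ^ 2 ≠ ∞) :
    MemLp (fun x : Vec d => x) 2 (μ : Measure (Vec d)) := by
  rw [W2_sq] at h
  obtain ⟨π, hπ⟩ := iInf_lt_iff.1 (lt_top_iff_ne_top.2 h)
  obtain ⟨⟨h1, h2⟩, hfin⟩ := iInf_lt_iff.1 hπ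
  -- A plan of finite cost makes `x - y` square integrable, and `x = (x - y) + y`.
  have hd : MemLp (fun p : Vec d × Vec d => p.1 - p.2) 2 π := by
    rw [memLp_two_iff_integrable_sq_norm (by fun_prop)]
    refine ⟨by fun_prop, ?_⟩
    rw [hasFiniteIntegral_iff_ofReal (Filter.Eventually.of_forall fun p => sq_nonneg _)]
    simpa only [edist_sq_eq_ofReal] using hfin
  have h3 : MemLp (fun p : Vec d × Vec d => p.2) 2 π := by
    rw [← h2, Measure.snd, memLp_map_measure_iff (by fun_prop) (by fun_prop)] at h'
    exact h'
  have h4 : MemLp (fun p : Vec d × Vec d => p.1) 2 π := by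
    convert hd.add h3 using 1
    ext1 p
    simp
  rw [← h1, Measure.fst, memLp_map_measure_iff (by fun_prop) (by fun_prop)]
  exact h4

/-- The Fréchet function of an arbitrary square integrable law is bounded below by the matrix
problem. -/
theorem ofReal_le_frechetFun {ν : ProbabilityMeasure (Vec d)} (hν : IsCentralLaw ν)
    (hw : w ∈ stdSimplex ℝ (Fin n)) (ms : Fin n → Vec d) (hSs : ∀ i, (Ss i).PosDef)
    {μ : ProbabilityMeasure (Vec d)} {m : Vec d} {C : Mat d}
    (h : HasMoments (μ : Measure (Vec d)) m C) {ε : ℝ} (hε : 0 < ε) :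
    ENNReal.ofReal (locFrechet w ms m + scatFrechet w Ss (C + ε • 1) - ε * d) ≤
      frechetFun w (fun i => LS ν (ms i) (Ss i)) μ := by
  -- The covariance `C` may be singular, so the transport matrix is taken from `C + ε`.
  have hP : (C + ε • (1 : Mat d)).PosDef :=
    Matrix.PosDef.posSemidef_add h.posSemidef (Matrix.PosDef.one.smul hε)
  have e1 : locFrechet w ms m + scatFrechet w Ss (C + ε • 1) - ε * d =
      ∑ i, w i * (‖m - ms i‖ ^ 2 + (C + ε • (1 : Mat d) + Ss i - (2 : ℝ) •
        CFC.sqrt (CFC.sqrt (Ss i) * (C + ε • (1 : Mat d)) * CFC.sqrt (Ss i))).trace - ε * d) := by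
    simp only [mul_add, mul_sub, Finset.sum_add_distrib, Finset.sum_sub_distrib, ← Finset.sum_mul,
      hw.2, locFrechet, scatFrechet, one_mul]
  rw [e1]
  refine (ofReal_sum_le_sum_ofReal_mul_ofReal hw.1).trans (Finset.sum_le_sum fun i _ => ?_)
  gcongr
  refine le_trans (ENNReal.ofReal_le_ofReal ?_)
    (gelbrich_le_W2_sq h (LS_hasMoments hν (ms i) (hSs i)) (brenier_posDef hP (hSs i)))
  have h1 := trace_brenier_mul hP (hSs i)
  have h2 := trace_inv_brenier_mul hP (hSs i)
  have h3 := (brenier_posDef hP (hSs i)).posSemidef.trace_nonneg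
  rw [Matrix.mul_add, Matrix.trace_add, Matrix.mul_smul, Matrix.mul_one, Matrix.trace_smul,
    smul_eq_mul] at h1
  rw [h2]
  simp only [Matrix.trace_add, Matrix.trace_sub, Matrix.trace_smul, smul_eq_mul, Matrix.trace_one,
    Fintype.card_fin]
  -- Passing from `C` to `C + ε` costs `ε d` in `Tr C`; the change `ε Tr T ≥ 0` in `Tr(T C)` has the
  -- favourable sign.
  nlinarith [mul_nonneg hε.le h3]

/-- The laws `LS ν m_B S`, with `m_B` the mean barycentre, give one bound. For the other, an
arbitrary law is replaced by its mean and regularized covariance, and `ε` tends to zero. -/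
theorem frechetVar_LS {ν : ProbabilityMeasure (Vec d)} (hν : IsCentralLaw ν)
    (hw : w ∈ stdSimplex ℝ (Fin n)) (ms : Fin n → Vec d) (hSs : ∀ i, (Ss i).PosDef) :
    frechetVar w (fun i => LS ν (ms i) (Ss i)) =
      ENNReal.ofReal (locFrechet w ms (meanBary w ms) + scatVar w Ss) := by
  apply le_antisymm
  · have h1 : ∀ S : Mat d, S.PosDef → frechetVar w (fun i => LS ν (ms i) (Ss i)) ≤
        ENNReal.ofReal (locFrechet w ms (meanBary w ms) + scatFrechet w Ss S) := fun S hS =>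
      (iInf_le _ _).trans_eq (frechetFun_LS hν hw.1 ms hSs _ hS)
    have htop : frechetVar w (fun i => LS ν (ms i) (Ss i)) ≠ ∞ :=
      ne_top_of_le_ne_top ENNReal.ofReal_ne_top (h1 1 Matrix.PosDef.one)
    rw [← ENNReal.ofReal_toReal htop]
    apply ENNReal.ofReal_le_ofReal
    rw [← sub_le_iff_le_add']
    have : Nonempty {S : Mat d // S.PosDef} := ⟨⟨1, Matrix.PosDef.one⟩⟩
    refine le_ciInf fun S => ?_
    rw [sub_le_iff_le_add']
    exact ENNReal.toReal_le_of_le_ofReal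
      (add_nonneg (locFrechet_nonneg hw.1 _ _) (scatFrechet_nonneg hw.1 hSs S.2)) (h1 S.1 S.2)
  · refine le_iInf fun μ => ?_
    by_cases htop : frechetFun w (fun i => LS ν (ms i) (Ss i)) μ = ∞
    · rw [htop]; exact le_top
    -- A zero weight would hide an infinite distance; the weights sum to one, so some weight is
    -- positive.
    obtain ⟨i, hi⟩ : ∃ i, 0 < w i := by
      by_contra! hcon
      have := Finset.sum_nonpos fun i (_ : i ∈ Finset.univ) => hcon i
      rw [hw.2] at this
      linarith
    have hW : W2 μ (LS ν (ms i) (Ss i)) ^ 2 ≠ ∞ := by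
      intro hcon
      apply htop
      refine ENNReal.sum_eq_top.2 ⟨i, Finset.mem_univ i, ?_⟩
      rw [hcon]
      exact ENNReal.mul_top (by simpa using hi)
    obtain ⟨m, C, hm⟩ := HasMoments.of_memLp
      (memLp_of_W2_ne_top (LS_hasMoments hν (ms i) (hSs i)).memLp hW)
    rw [ENNReal.ofReal_le_iff_le_toReal htop]
    have key : ∀ ε : ℝ, 0 < ε → locFrechet w ms (meanBary w ms) + scatVar w Ss ≤
        (frechetFun w (fun i => LS ν (ms i) (Ss i)) μ).toReal + ε * d := fun ε hε => by
      have h1 := (ENNReal.ofReal_le_iff_le_toReal htop).1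
        (ofReal_le_frechetFun hν hw ms hSs hm hε)
      have h2 := scatVar_le hw.1 hSs
        (Matrix.PosDef.posSemidef_add hm.posSemidef (Matrix.PosDef.one.smul hε))
      have h3 := locFrechet_sub w hw.2 ms m
      nlinarith [sq_nonneg ‖m - meanBary w ms‖]
    refine le_of_forall_pos_le_add fun δ hδ => ?_
    -- This choice keeps `ε d ≤ δ`, including for `d = 0`.
    refine (key (δ / (d + 1)) (by positivity)).trans ?_
    gcongr
    rw [div_mul_eq_mul_div, div_le_iff₀ (by positivity)]
    nlinarith

theorem scatPenalty_nonneg (hw : ∀ i, 0 ≤ w i) (hSs : ∀ i, (Ss i).PosDef) (hS : S.PosDef) :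
    0 ≤ scatPenalty w Ss S :=
  sub_nonneg.2 (scatVar_le hw hSs hS)

theorem locPenalty_nonneg (hw : ∑ i, w i = 1) (ms : Fin n → Vec d) (m : Vec d) :
    0 ≤ locPenalty w ms m := by
  rw [locPenalty, locFrechet_sub w hw]
  exact sq_nonneg _

theorem normFrechetFun_LS {ν : ProbabilityMeasure (Vec d)} (hν : IsCentralLaw ν)
    (hw : w ∈ stdSimplex ℝ (Fin n)) (ms : Fin n → Vec d) (hSs : ∀ i, (Ss i).PosDef) (m : Vec d)
    (hS : S.PosDef) :
    normFrechetFun w (fun i => LS ν (ms i) (Ss i)) (LS ν m S) =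
      ENNReal.ofReal (locPenalty w ms m + scatPenalty w Ss S) := by
  rw [normFrechetFun, frechetFun_LS hν hw.1 ms hSs m hS, frechetVar_LS hν hw ms hSs,
    ← ENNReal.ofReal_sub _ (add_nonneg (locFrechet_nonneg hw.1 _ _) (scatVar_nonneg hw.1 hSs)),
    locPenalty, scatPenalty]
  congr 1
  ring

theorem expect_eq_integral {μ : ProbabilityMeasure (Vec d)} {f : Vec d → ℝ}
    (hf : Integrable f (μ : Measure (Vec d))) :
    expect μ f = ((∫ z, f z ∂(μ : Measure (Vec d)) : ℝ) : EReal) := by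
  have h1 : ∫⁻ z, ENNReal.ofReal (f z) ∂(μ : Measure (Vec d)) ≠ ∞ := hf.lintegral_lt_top.ne
  have h2 : ∫⁻ z, ENNReal.ofReal (-f z) ∂(μ : Measure (Vec d)) ≠ ∞ := hf.neg.lintegral_lt_top.ne
  rw [expect, integral_eq_lintegral_pos_part_sub_lintegral_neg_part hf, EReal.coe_sub,
    EReal.coe_ennreal_toReal h1, EReal.coe_ennreal_toReal h2]

/-- The risk measure of a location-scatter family is the value of a matrix problem. -/
theorem wassersteinRisk_lsFamily {ν : ProbabilityMeasure (Vec d)} (hν : IsCentralLaw ν)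
    {γ : ℝ} (hγ : 0 < γ) (hw : w ∈ stdSimplex ℝ (Fin n)) (ms : Fin n → Vec d)
    (hSs : ∀ i, (Ss i).PosDef) {Φ₀ : Vec d → ℝ} (hΦ₀ : Measurable Φ₀)
    (hint : ∀ (m : Vec d) (S : Mat d), S.PosDef →
      Integrable (fun z => Φ₀ (lsMap m S z)) (ν : Measure (Vec d))) :
    wassersteinRisk (lsFamily ν) γ w (fun i => LS ν (ms i) (Ss i)) (fun z => -Φ₀ z) =
      ⨆ p ∈ feasible d, ((objective ν Φ₀ γ w ms Ss p : ℝ) : EReal) := by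
  have key : ∀ (m : Vec d) (S : Mat d), S.PosDef →
      expect (LS ν m S) (fun z => - -Φ₀ z) - ((ENNReal.ofReal (1 / (2 * γ)) *
        normFrechetFun w (fun i => LS ν (ms i) (Ss i)) (LS ν m S) : ℝ≥0∞) : EReal) =
      ((objective ν Φ₀ γ w ms Ss (m, S) : ℝ) : EReal) := fun m S hS => by
    have hmeas := (continuous_lsMap m S).measurable.aemeasurable (μ := (ν : Measure (Vec d)))
    have hI : Integrable Φ₀ (LS ν m S : Measure (Vec d)) :=
      (integrable_map_measure hΦ₀.aestronglyMeasurable hmeas).2 (hint m S hS)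
    have hE : ∫ z, Φ₀ z ∂(LS ν m S : Measure (Vec d)) = riskFun ν Φ₀ m S :=
      integral_map hmeas hΦ₀.aestronglyMeasurable
    have hp : 0 ≤ locPenalty w ms m + scatPenalty w Ss S :=
      add_nonneg (locPenalty_nonneg hw.2 ms m) (scatPenalty_nonneg hw.1 hSs hS)
    simp only [neg_neg]
    rw [expect_eq_integral hI, hE, normFrechetFun_LS hν hw ms hSs m hS,
      ← ENNReal.ofReal_mul (by positivity), EReal.coe_ennreal_ofReal,
      max_eq_left (mul_nonneg (by positivity) hp), ← EReal.coe_sub]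
    rfl
  unfold wassersteinRisk
  apply le_antisymm
  · refine iSup₂_le ?_
    rintro _ ⟨m, S, hS, rfl⟩
    rw [key m S hS]
    exact le_iSup₂_of_le (f := fun p (_ : p ∈ feasible d) =>
      ((objective ν Φ₀ γ w ms Ss p : ℝ) : EReal)) (m, S) hS le_rfl
  · refine iSup₂_le ?_
    rintro ⟨m, S⟩ hS
    rw [← key m S hS]
    exact le_iSup₂_of_le (f := fun μ (_ : μ ∈ lsFamily ν) => expect μ (fun z => - -Φ₀ z) -
      ((ENNReal.ofReal (1 / (2 * γ)) * normFrechetFun w (fun i => LS ν (ms i) (Ss i)) μ : ℝ≥0∞) :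
        EReal)) (LS ν m S) ⟨m, S, hS, rfl⟩ le_rfl

end RiskMeasure

end BarycentricRisk

namespace BarycentricRisk

open scoped Matrix.Norms.L2Operator

/-! ### Differentiating the risk function under the integral. -/

section RiskDerivative

variable {d n : ℕ}

/-- The action of matrices on Euclidean space, as a continuous linear map. -/
noncomputable def matAction (d : ℕ) : Mat d →L[ℝ] Vec d →L[ℝ] Vec d :=
  LinearMap.toContinuousLinearMap
    { toFun := fun A => Matrix.toEuclideanCLM (𝕜 := ℝ) A
      map_add' := fun A B => map_add _ A B
      map_smul' := fun c A => map_smul (Matrix.toEuclideanCLM (n := Fin d) (𝕜 := ℝ)) c A }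

theorem matAction_apply (A : Mat d) (z : Vec d) :
    matAction d A z = Matrix.toEuclideanCLM (𝕜 := ℝ) A z := rfl

theorem matAction_mul (A B : Mat d) (z : Vec d) :
    matAction d (A * B) z = matAction d A (matAction d B z) := toEuclideanCLM_mul_apply A B z

theorem norm_matAction_le (A : Mat d) (z : Vec d) : ‖matAction d A z‖ ≤ ‖A‖ * ‖z‖ :=
  (Matrix.toEuclideanCLM (𝕜 := ℝ) A).le_opNorm z

variable {ν : ProbabilityMeasure (Vec d)} {Φ₀ : Vec d → ℝ} {m : Vec d} {S : Mat d}

theorem DominatedNear.exists_bound (hdom : DominatedNear ν Φ₀ m S) (hS : S.PosDef) :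
    ∃ g : Vec d → ℝ, Integrable g (ν : Measure (Vec d)) ∧
      ∀ᵐ z ∂(ν : Measure (Vec d)), ‖fderiv ℝ Φ₀ (lsMap m S z)‖ * (1 + ‖z‖) ≤ g z := by
  obtain ⟨N, hN, g, hg, hb⟩ := hdom
  exact ⟨g, hg, hb.mono fun z hz => hz (m, S) (mem_of_mem_nhds hN) hS⟩

theorem continuous_fderiv_lsMap (hΦ : ContDiff ℝ 1 Φ₀) :
    Continuous fun z => fderiv ℝ Φ₀ (lsMap m S z) :=
  (hΦ.continuous_fderiv one_ne_zero).comp (continuous_lsMap m S)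

/-- The factor `1 + ‖z‖` in `DominatedNear` absorbs any direction affine in `z`. The integrands of
`gradM` and `psiMat` are special cases. -/
theorem integrable_fderiv_affine (hΦ : ContDiff ℝ 1 Φ₀) (hdom : DominatedNear ν Φ₀ m S)
    (hS : S.PosDef) (h : Vec d) (B : Mat d) :
    Integrable (fun z => fderiv ℝ Φ₀ (lsMap m S z) (h + matAction d B z))
      (ν : Measure (Vec d)) := by
  obtain ⟨g, hg, hb⟩ := hdom.exists_bound hS
  have hc : Continuous fun z => fderiv ℝ Φ₀ (lsMap m S z) (h + matAction d B z) :=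
    (continuous_fderiv_lsMap hΦ).clm_apply (by fun_prop)
  refine (hg.const_mul (‖h‖ + ‖B‖)).mono' hc.aestronglyMeasurable ?_
  filter_upwards [hb] with z hz
  calc _ ≤ ‖fderiv ℝ Φ₀ (lsMap m S z)‖ * ‖h + matAction d B z‖ := ContinuousLinearMap.le_opNorm _ _
    _ ≤ ‖fderiv ℝ Φ₀ (lsMap m S z)‖ * ((‖h‖ + ‖B‖) * (1 + ‖z‖)) := by
        gcongr
        refine (norm_add_le _ _).trans ?_
        nlinarith [norm_matAction_le B z, norm_nonneg h, norm_nonneg B, norm_nonneg z,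
          mul_nonneg (norm_nonneg h) (norm_nonneg z)]
    _ = (‖h‖ + ‖B‖) * (‖fderiv ℝ Φ₀ (lsMap m S z)‖ * (1 + ‖z‖)) := by ring
    _ ≤ (‖h‖ + ‖B‖) * g z := by gcongr

theorem fderiv_eq_sum_partialD (Φ₀ : Vec d → ℝ) (x v : Vec d) :
    fderiv ℝ Φ₀ x v = ∑ l, partialD Φ₀ l x * v l := by
  have hv : v = ∑ l, v l • EuclideanSpace.single l (1 : ℝ) := by
    ext k
    simp [Pi.single_apply]
  conv_lhs => rw [hv]
  simp only [map_sum, map_smul, partialD, smul_eq_mul, mul_comm]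

theorem integrable_partialD (hΦ : ContDiff ℝ 1 Φ₀) (hdom : DominatedNear ν Φ₀ m S)
    (hS : S.PosDef) (l : Fin d) :
    Integrable (fun z => partialD Φ₀ l (lsMap m S z)) (ν : Measure (Vec d)) := by
  have h := integrable_fderiv_affine hΦ hdom hS (EuclideanSpace.single l 1) 0
  simpa [partialD] using h

theorem integrable_partialD_mul (hΦ : ContDiff ℝ 1 Φ₀) (hdom : DominatedNear ν Φ₀ m S)
    (hS : S.PosDef) (l k : Fin d) :
    Integrable (fun z => partialD Φ₀ l (lsMap m S z) * z k) (ν : Measure (Vec d)) := by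
  have h := integrable_fderiv_affine hΦ hdom hS 0 (Matrix.single l k 1)
  refine h.congr (Filter.Eventually.of_forall fun z => ?_)
  simp only [zero_add]
  rw [fderiv_eq_sum_partialD]
  have h1 : ∀ j, matAction d (Matrix.single l k 1) z j = if j = l then z k else 0 := fun j => by
    rw [matAction_apply, Matrix.ofLp_toEuclideanCLM]
    simp [Matrix.mulVec, dotProduct, Matrix.single_apply, eq_comm, ite_and]
  simp [h1]

theorem integral_fderiv_affine (hΦ : ContDiff ℝ 1 Φ₀) (hdom : DominatedNear ν Φ₀ m S)
    (hS : S.PosDef) (h : Vec d) (B : Mat d) :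
    ∫ z, fderiv ℝ Φ₀ (lsMap m S z) (h + matAction d B z) ∂(ν : Measure (Vec d)) =
      inner ℝ (gradM ν Φ₀ m S) h + ((psiMat ν Φ₀ m S)ᵀ * B).trace := by
  have hi1 : ∀ l, Integrable (fun z => partialD Φ₀ l (lsMap m S z) * h l)
      (ν : Measure (Vec d)) := fun l => (integrable_partialD hΦ hdom hS l).mul_const _
  have hi2 : ∀ l k, Integrable (fun z => B l k * (partialD Φ₀ l (lsMap m S z) * z k))
      (ν : Measure (Vec d)) := fun l k => (integrable_partialD_mul hΦ hdom hS l k).const_mul _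
  have e1 : ∀ z, fderiv ℝ Φ₀ (lsMap m S z) (h + matAction d B z) =
      ∑ l, partialD Φ₀ l (lsMap m S z) * h l +
        ∑ l, ∑ k, B l k * (partialD Φ₀ l (lsMap m S z) * z k) := fun z => by
    rw [fderiv_eq_sum_partialD, ← Finset.sum_add_distrib]
    refine Finset.sum_congr rfl fun l _ => ?_
    rw [PiLp.add_apply, mul_add, matAction_apply, Matrix.ofLp_toEuclideanCLM, Matrix.mulVec,
      dotProduct, Finset.mul_sum]
    congr 1
    exact Finset.sum_congr rfl fun k _ => by ring
  simp only [e1]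
  rw [integral_add (integrable_finsetSum _ fun l _ => hi1 l)
    (integrable_finsetSum _ fun l _ => integrable_finsetSum _ fun k _ => hi2 l k),
    integral_finsetSum _ fun l _ => hi1 l]
  congr 1
  · simp only [integral_mul_const, gradM, PiLp.inner_apply]
    exact Finset.sum_congr rfl fun l _ => by simp [mul_comm]
  · rw [integral_finsetSum Finset.univ
      (f := fun l (z : Vec d) => ∑ k, B l k * (partialD Φ₀ l (lsMap m S z) * z k))
      fun l _ => integrable_finsetSum _ fun k _ => hi2 l k]
    simp only [Matrix.trace, Matrix.diag, Matrix.mul_apply, Matrix.transpose_apply]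
    rw [Finset.sum_comm]
    refine Finset.sum_congr rfl fun l _ => ?_
    rw [integral_finsetSum _ fun k _ => hi2 l k]
    refine Finset.sum_congr rfl fun k _ => ?_
    rw [integral_const_mul, psiMat, Matrix.of_apply, mul_comm]

/-- Differentiation under the integral sign along a curve of square roots. -/
theorem hasDerivAt_riskFun_line (hΦ : ContDiff ℝ 1 Φ₀) (hdom : DominatedNear ν Φ₀ m S)
    (hS : S.PosDef)
    (hint : ∀ (m : Vec d) (S : Mat d), S.PosDef →
      Integrable (fun z => Φ₀ (lsMap m S z)) (ν : Measure (Vec d)))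
    (h : Vec d) {H L : Mat d} (hH : H.IsHermitian)
    (hL : HasDerivAt (fun ε : ℝ => CFC.sqrt (S + ε • H)) L 0) :
    HasDerivAt (fun ε : ℝ => riskFun ν Φ₀ (m + ε • h) (S + ε • H))
      (∫ z, fderiv ℝ Φ₀ (lsMap m S z) (h + matAction d L z) ∂(ν : Measure (Vec d))) 0 := by
  have hI := integrable_fderiv_affine hΦ hdom hS h L
  obtain ⟨N, hN, g, hg, hb⟩ := hdom
  set R := CFC.sqrt S with hRdef
  have hR : R.PosDef := sqrt_posDef hS
  have hRR : R * R = S := sqrt_mul_sqrt hS.posSemidef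
  have hline : HasDerivAt (fun ε : ℝ => S + ε • H) H 0 := by
    simpa using ((hasDerivAt_id (0 : ℝ)).smul_const H).const_add S
  have hline' : HasDerivAt (fun ε : ℝ => m + ε • h) h 0 := by
    simpa using ((hasDerivAt_id (0 : ℝ)).smul_const h).const_add m
  -- the curve `ε ↦ (m + ε h, (S + ε H)^{1/2})`
  set q : ℝ → Vec d × Mat d := fun ε => (m + ε • h, CFC.sqrt (S + ε • H)) with hq
  have hqd : HasDerivAt q (h, L) 0 := hline'.prodMk hL
  have hq0 : q 0 = (m, R) := by simp [hq, hRdef]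
  -- The map `lsMap` is affine in the root of `S`, not in `S`. The neighbourhood is pulled back to
  -- root coordinates, where a ball is convex.
  have hsq : Continuous fun p : Vec d × Mat d => (p.1, p.2 * p.2) := by fun_prop
  have hpre : (fun p : Vec d × Mat d => (p.1, p.2 * p.2)) ⁻¹' N ∈ 𝓝 (m, R) :=
    hsq.continuousAt.preimage_mem_nhds (by simpa [hRR] using hN)
  obtain ⟨r, hr, hball⟩ := Metric.mem_nhds_iff.1 hpre
  obtain ⟨K, hK⟩ := hqd.hasFDerivAt.isBigO_sub.bound
  have hqball : ∀ᶠ ε in 𝓝 (0 : ℝ), q ε ∈ Metric.ball (m, R) r := by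
    have := hqd.continuousAt.tendsto
    rw [hq0] at this
    exact this.eventually (Metric.ball_mem_nhds _ hr)
  have hpos : ∀ᶠ ε in 𝓝 (0 : ℝ), (S + ε • H).PosDef := by
    have h1 : Filter.Tendsto (fun ε : ℝ => S + ε • H) (𝓝 0) (𝓝 S) := by
      simpa using hline.continuousAt.tendsto
    filter_upwards [h1.eventually (eventually_posDef hS)] with ε hε
    exact hε (hS.1.add (hH.smul (IsSelfAdjoint.all ε)))
  have hs := hK.and (hqball.and hpos)
  have hF'c : Continuous fun z => (1 : ℝ →L[ℝ] ℝ).smulRight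
      (fderiv ℝ Φ₀ (lsMap m S z) (h + matAction d L z)) :=
    (ContinuousLinearMap.smulRightL ℝ ℝ ℝ 1).continuous.comp
      ((continuous_fderiv_lsMap hΦ).clm_apply (by fun_prop))
  -- This version needs a Lipschitz bound only relative to the base point `ε = 0`.
  have hF := hasFDerivAt_integral_of_dominated_loc_of_lip' (𝕜 := ℝ) (μ := (ν : Measure (Vec d)))
    (F := fun (ε : ℝ) z => Φ₀ (lsMap (m + ε • h) (S + ε • H) z)) (x₀ := 0)
    (F' := fun z => (1 : ℝ →L[ℝ] ℝ).smulRight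
      (fderiv ℝ Φ₀ (lsMap m S z) (h + matAction d L z)))
    (bound := fun z => K * g z) hs
    (fun ε _ => (hΦ.continuous.comp (continuous_lsMap _ _)).aestronglyMeasurable)
    (by simpa using hint m S hS)
    hF'c.aestronglyMeasurable
    ?_ (hg.const_mul K) ?_
  · obtain ⟨hFi, hFd⟩ := hF
    have h1 := hFd.hasDerivAt
    rw [ContinuousLinearMap.integral_apply hFi] at h1
    simpa [riskFun] using h1
  · filter_upwards [hb] with z hz ε hε
    obtain ⟨hε1, hε2, hε3⟩ := hε
    rw [hq0, sub_zero] at hε1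
    -- Each point of the segment is an image under `lsMap` whose root is a convex combination of the
    -- end roots, so the domination hypothesis applies to the square of that root.
    have hseg : ∀ x ∈ segment ℝ (lsMap m S z) (lsMap (m + ε • h) (S + ε • H) z),
        ‖fderiv ℝ Φ₀ x‖ ≤ g z / (1 + ‖z‖) := by
      rintro _ ⟨a, b, ha, hb', hab, rfl⟩
      have hB : (a • R + b • CFC.sqrt (S + ε • H)).PosDef := by
        rcases ha.eq_or_lt with rfl | ha'
        · rw [zero_add] at hab
          simpa [hab] using sqrt_posDef hε3
        · exact (hR.smul ha').add_posSemidef ((sqrt_posSemidef _).smul hb')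
      have hmem : a • (m, R) + b • q ε ∈ Metric.ball (m, R) r :=
        convex_ball (m, R) r (Metric.mem_ball_self hr) hε2 ha hb' hab
      have h1 := hz _ (hball hmem) (by simpa [hB.1.eq] using posDef_conj Matrix.PosDef.one hB)
      have h2 : lsMap (a • (m, R) + b • q ε).1 ((a • (m, R) + b • q ε).2 *
          (a • (m, R) + b • q ε).2) z =
          a • lsMap m S z + b • lsMap (m + ε • h) (S + ε • H) z := by
        have h3 : (a • (m, R) + b • q ε).2 = a • R + b • CFC.sqrt (S + ε • H) := rfl
        have h4 : (a • (m, R) + b • q ε).1 = a • m + b • (m + ε • h) := rfl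
        rw [h3, h4]
        simp only [lsMap, sqrt_mul_self_eq hB.posSemidef, ← matAction_apply, map_add, map_smul,
          _root_.add_apply, _root_.smul_apply]
        module
      rw [h2] at h1
      rwa [le_div_iff₀ (by positivity)]
    have h5 := (convex_segment (lsMap m S z)
      (lsMap (m + ε • h) (S + ε • H) z)).norm_image_sub_le_of_norm_fderiv_le
      (fun x _ => (hΦ.differentiable one_ne_zero).differentiableAt) hseg
      (left_mem_segment ℝ _ _) (right_mem_segment ℝ _ _)
    -- The growth `1 + ‖z‖` of the displacement cancels the denominator in the gradient bound.
    have h6 : ‖lsMap (m + ε • h) (S + ε • H) z - lsMap m S z‖ ≤ K * ‖ε‖ * (1 + ‖z‖) := by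
      have e1 : lsMap (m + ε • h) (S + ε • H) z - lsMap m S z =
          (q ε - (m, R)).1 + matAction d (q ε - (m, R)).2 z := by
        have h3 : (q ε - (m, R)).2 = CFC.sqrt (S + ε • H) - R := rfl
        have h4 : (q ε - (m, R)).1 = m + ε • h - m := rfl
        rw [h3, h4, map_sub, _root_.sub_apply, matAction_apply, matAction_apply, lsMap, lsMap]
        abel
      rw [e1]
      calc _ ≤ ‖(q ε - (m, R)).1‖ + ‖(q ε - (m, R)).2‖ * ‖z‖ :=
            (norm_add_le _ _).trans (by gcongr; exact norm_matAction_le _ _)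
        _ ≤ ‖q ε - (m, R)‖ + ‖q ε - (m, R)‖ * ‖z‖ := by
            gcongr
            · exact norm_fst_le _
            · exact norm_snd_le _
        _ = ‖q ε - (m, R)‖ * (1 + ‖z‖) := by ring
        _ ≤ _ := by gcongr
    have h7 : 0 ≤ g z / (1 + ‖z‖) := (norm_nonneg _).trans (hseg _ (left_mem_segment ℝ _ _))
    simp only [zero_smul, add_zero, sub_zero]
    calc _ ≤ g z / (1 + ‖z‖) * (K * ‖ε‖ * (1 + ‖z‖)) := h5.trans (by gcongr)
      _ = K * g z * ‖ε‖ := by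
          have : (1 + ‖z‖) ≠ 0 := by positivity
          field_simp
  · refine Filter.Eventually.of_forall fun z => ?_
    have h1 : HasDerivAt (fun ε : ℝ => lsMap (m + ε • h) (S + ε • H) z)
        (h + matAction d L z) 0 := by
      refine hline'.add ?_
      exact ((ContinuousLinearMap.apply ℝ (Vec d) z).comp (matAction d)).hasFDerivAt.comp_hasDerivAt
        (0 : ℝ) hL
    have h2 : HasFDerivAt Φ₀ (fderiv ℝ Φ₀ (lsMap m S z))
        (lsMap (m + (0 : ℝ) • h) (S + (0 : ℝ) • H) z) := by
      simpa using (hΦ.differentiable one_ne_zero).differentiableAt.hasFDerivAt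
    have h3 := (h2.comp_hasDerivAt (0 : ℝ) h1).hasFDerivAt
    refine HasFDerivAt.congr_fderiv
      (f := fun ε : ℝ => Φ₀ (lsMap (m + ε • h) (S + ε • H) z)) h3 ?_
    ext
    simp

end RiskDerivative

end BarycentricRisk

namespace BarycentricRisk

open scoped Matrix.Norms.L2Operator

/-! ### Symmetry from rotation invariance, the gradient formula and the first order conditions. -/

section RotationInvariance

variable {d n : ℕ}

/-- Skewness turns transposition into inversion. The determinant is the square of that of `exp((t /
2) A)`, so it cannot be `-1`. -/
theorem exp_smul_mem_specialOrthogonalGroup {A : Mat d} (hA : Aᵀ = -A) (t : ℝ) :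
    NormedSpace.exp (t • A) ∈ Matrix.specialOrthogonalGroup (Fin d) ℝ := by
  have horth : ∀ s : ℝ, NormedSpace.exp (s • A) ∈ Matrix.orthogonalGroup (Fin d) ℝ := fun s => by
    rw [Matrix.mem_orthogonalGroup_iff, ← Matrix.exp_transpose, Matrix.transpose_smul, hA,
      smul_neg, Matrix.exp_neg]
    exact Matrix.mul_nonsing_inv _ ((Matrix.isUnit_iff_isUnit_det _).1 (Matrix.isUnit_exp _))
  refine Matrix.mem_specialOrthogonalGroup_iff.2 ⟨horth t, ?_⟩
  have h1 := congrArg Matrix.det ((Matrix.mem_orthogonalGroup_iff _ _).1 (horth t))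
  rw [Matrix.det_mul, Matrix.det_transpose, Matrix.det_one] at h1
  have h2 : (NormedSpace.exp (t • A)).det = (NormedSpace.exp ((t / 2) • A)).det ^ 2 := by
    rw [← Matrix.det_pow, ← Matrix.exp_nsmul, ← Nat.cast_smul_eq_nsmul ℝ, smul_smul]
    congr 3
    push_cast
    ring
  nlinarith [sq_nonneg (NormedSpace.exp ((t / 2) • A)).det]

variable {ν : ProbabilityMeasure (Vec d)} {Φ₀ : Vec d → ℝ} {m : Vec d} {S : Mat d}

theorem IsCentralLaw.integral_rotation (hν : IsCentralLaw ν) {U : Mat d}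
    (hU : U ∈ Matrix.specialOrthogonalGroup (Fin d) ℝ) {f : Vec d → ℝ} (hf : Continuous f) :
    ∫ z, f (matAction d U z) ∂(ν : Measure (Vec d)) = ∫ z, f z ∂(ν : Measure (Vec d)) := by
  conv_rhs => rw [← hν.rotation U hU]
  rw [integral_map (by fun_prop) hf.aestronglyMeasurable]
  rfl

theorem IsCentralLaw.integrable_rotation (hν : IsCentralLaw ν) {U : Mat d}
    (hU : U ∈ Matrix.specialOrthogonalGroup (Fin d) ℝ) {f : Vec d → ℝ}
    (hf : Integrable f (ν : Measure (Vec d))) :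
    Integrable (fun z => f (matAction d U z)) (ν : Measure (Vec d)) := by
  have h : MeasurePreserving (matAction d U) (ν : Measure (Vec d)) (ν : Measure (Vec d)) :=
    ⟨(matAction d U).continuous.measurable, hν.rotation U hU⟩
  exact h.integrable_comp_of_integrable hf

/-- Infinitesimal rotations do not change the risk function. -/
theorem integral_fderiv_skew (hν : IsCentralLaw ν) (hΦ : ContDiff ℝ 1 Φ₀)
    (hdom : DominatedNear ν Φ₀ m S) (hS : S.PosDef)
    (hint : Integrable (fun z => Φ₀ (lsMap m S z)) (ν : Measure (Vec d)))
    {A : Mat d} (hA : Aᵀ = -A) :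
    ∫ z, fderiv ℝ Φ₀ (lsMap m S z) (0 + matAction d (CFC.sqrt S * A) z)
      ∂(ν : Measure (Vec d)) = 0 := by
  set U : ℝ → Mat d := fun t => NormedSpace.exp (t • A) with hUdef
  have hU : ∀ t, U t ∈ Matrix.specialOrthogonalGroup (Fin d) ℝ :=
    exp_smul_mem_specialOrthogonalGroup hA
  have hUd : ∀ t, HasDerivAt U (A * U t) t := fun t => hasDerivAt_exp_smul_const' A t
  have hUc : Continuous U := continuous_iff_continuousAt.2 fun t => (hUd t).continuousAt
  set G : Vec d → ℝ := fun z => fderiv ℝ Φ₀ (lsMap m S z) (0 + matAction d (CFC.sqrt S * A) z)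
    with hG
  have hGc : Continuous G := (continuous_fderiv_lsMap hΦ).clm_apply (by fun_prop)
  have hGi : Integrable G (ν : Measure (Vec d)) := integrable_fderiv_affine hΦ hdom hS 0 _
  have hjoint : Continuous fun p : ℝ × Vec d => G (matAction d (U p.1) p.2) :=
    hGc.comp (((matAction d).continuous.comp (hUc.comp continuous_fst)).clm_apply continuous_snd)
  have hderiv : ∀ z t, HasDerivAt (fun s => Φ₀ (lsMap m S (matAction d (U s) z)))
      (G (matAction d (U t) z)) t := fun z t => by
    have h1 : HasDerivAt (fun s => lsMap m S (matAction d (U s) z))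
        (0 + matAction d (CFC.sqrt S * A) (matAction d (U t) z)) t := by
      refine (hasDerivAt_const t m).add ?_
      have h2 : HasDerivAt (fun s => matAction d (U s) z) (matAction d (A * U t) z) t :=
        ((ContinuousLinearMap.apply ℝ (Vec d) z).comp (matAction d)).hasFDerivAt.comp_hasDerivAt
          t (hUd t)
      rw [matAction_mul (CFC.sqrt S), ← matAction_mul A]
      exact (matAction d (CFC.sqrt S)).hasFDerivAt.comp_hasDerivAt t h2
    exact ((hΦ.differentiable one_ne_zero).differentiableAt.hasFDerivAt).comp_hasDerivAt t h1
  -- The roots `S^{1/2} U t` are in general not positive definite, so the domination hypothesis does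
  -- not cover this curve. Instead the derivative is integrated over `t` and the integrals are
  -- exchanged; by invariance every inner integral equals that of `G`.
  have hFTC : ∀ z, ∫ t in (0 : ℝ)..1, G (matAction d (U t) z) =
      Φ₀ (lsMap m S (matAction d (U 1) z)) - Φ₀ (lsMap m S (matAction d (U 0) z)) := fun z =>
    intervalIntegral.integral_eq_sub_of_hasDerivAt (fun t _ => hderiv z t)
      ((hjoint.comp (Continuous.prodMk_left z)).intervalIntegrable 0 1)
  have hzero : ∫ z, (∫ t in (0 : ℝ)..1, G (matAction d (U t) z)) ∂(ν : Measure (Vec d)) = 0 := by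
    have hc : Continuous fun z => Φ₀ (lsMap m S z) := hΦ.continuous.comp (continuous_lsMap m S)
    simp only [hFTC]
    rw [integral_sub (hν.integrable_rotation (hU 1) hint) (hν.integrable_rotation (hU 0) hint),
      hν.integral_rotation (hU 1) hc, hν.integral_rotation (hU 0) hc, sub_self]
  have hprod : Integrable (Function.uncurry fun (z : Vec d) (t : ℝ) => G (matAction d (U t) z))
      ((ν : Measure (Vec d)).prod (volume.restrict (Set.Ioc 0 1))) := by
    have hsm : AEStronglyMeasurable
        (Function.uncurry fun (z : Vec d) (t : ℝ) => G (matAction d (U t) z))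
        ((ν : Measure (Vec d)).prod (volume.restrict (Set.Ioc 0 1))) :=
      (hjoint.comp continuous_swap).aestronglyMeasurable
    rw [integrable_prod_iff' hsm]
    refine ⟨Filter.Eventually.of_forall fun t => hν.integrable_rotation (hU t) hGi, ?_⟩
    have h1 : ∀ t, ∫ z, ‖G (matAction d (U t) z)‖ ∂(ν : Measure (Vec d)) =
        ∫ z, ‖G z‖ ∂(ν : Measure (Vec d)) := fun t =>
      hν.integral_rotation (hU t) (f := fun z => ‖G z‖) hGc.norm
    simp only [Function.uncurry_apply_pair, h1]
    exact integrable_const _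
  simp only [intervalIntegral.integral_of_le zero_le_one] at hzero
  rw [integral_integral_swap hprod] at hzero
  simp only [hν.integral_rotation (hU _) hGc] at hzero
  simpa using hzero

/-- `Ψᵀ S^{1/2}` is symmetric. -/
theorem psiMat_transpose_mul_sqrt (hν : IsCentralLaw ν) (hΦ : ContDiff ℝ 1 Φ₀)
    (hdom : DominatedNear ν Φ₀ m S) (hS : S.PosDef)
    (hint : Integrable (fun z => Φ₀ (lsMap m S z)) (ν : Measure (Vec d))) :
    (psiMat ν Φ₀ m S)ᵀ * CFC.sqrt S = CFC.sqrt S * psiMat ν Φ₀ m S := by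
  set M := (psiMat ν Φ₀ m S)ᵀ * CFC.sqrt S with hM
  have hRt : (CFC.sqrt S)ᵀ = CFC.sqrt S := by
    rw [← Matrix.conjTranspose_eq_transpose_of_trivial, (sqrt_posDef hS).1.eq]
  have hMt : Mᵀ = CFC.sqrt S * psiMat ν Φ₀ m S := by
    rw [hM, Matrix.transpose_mul, Matrix.transpose_transpose, hRt]
  rw [← hMt]
  -- Testing with the skew part of `M` itself makes the squared Frobenius norm of `M - Mᵀ` vanish.
  have hA : (Mᵀ - M)ᵀ = -(Mᵀ - M) := by
    rw [Matrix.transpose_sub, Matrix.transpose_transpose, neg_sub]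
  have h1 := integral_fderiv_skew hν hΦ hdom hS hint hA
  rw [integral_fderiv_affine hΦ hdom hS, inner_zero_right, zero_add, ← Matrix.mul_assoc, ← hM]
    at h1
  have h2 : (M * (Mᵀ - M)).trace = 0 := h1
  have h3 : ((M - Mᵀ)ᴴ * (M - Mᵀ)).trace = 0 := by
    rw [Matrix.conjTranspose_eq_transpose_of_trivial, Matrix.transpose_sub,
      Matrix.transpose_transpose]
    have h4 : (Mᵀ * (Mᵀ - M)).trace = (Mᵀ * Mᵀ).trace - (M * Mᵀ).trace := by
      rw [Matrix.mul_sub, Matrix.trace_sub, Matrix.trace_mul_comm Mᵀ M]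
    have h5 : (Mᵀ * Mᵀ).trace = (M * M).trace := by
      rw [← Matrix.transpose_mul, Matrix.trace_transpose]
    have h6 : (Mᵀ - M) * (M - Mᵀ) = Mᵀ * M - Mᵀ * Mᵀ - M * M + M * Mᵀ := by noncomm_ring
    rw [Matrix.mul_sub, Matrix.trace_sub] at h2
    rw [h6, Matrix.trace_add, Matrix.trace_sub, Matrix.trace_sub, h5, Matrix.trace_mul_comm Mᵀ M]
    linarith
  exact sub_eq_zero.1 ((Matrix.trace_conjTranspose_mul_self_eq_zero_iff).1 h3)

/-- Symmetry of `Ψᵀ R`, with `R = S^{1/2}`, gives `R⁻¹ Ψᵀ = Ψ R⁻¹`, so `gradS` is `½ Ψ R⁻¹`.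
Inserting `H = R L + L R` then yields `Tr(Ψ L)` without solving for `L`. -/
theorem trace_psiMat_transpose_mul (hν : IsCentralLaw ν) (hΦ : ContDiff ℝ 1 Φ₀)
    (hdom : DominatedNear ν Φ₀ m S) (hS : S.PosDef)
    (hint : Integrable (fun z => Φ₀ (lsMap m S z)) (ν : Measure (Vec d)))
    {L H : Mat d} (hL : L.IsHermitian) (hLH : CFC.sqrt S * L + L * CFC.sqrt S = H) :
    ((psiMat ν Φ₀ m S)ᵀ * L).trace = (gradS ν Φ₀ m S * H).trace := by
  have hsymm := psiMat_transpose_mul_sqrt hν hΦ hdom hS hint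
  have hR := sqrt_posDef hS
  rw [gradS]
  set Ψ := psiMat ν Φ₀ m S
  set R := CFC.sqrt S
  have hLt : Lᵀ = L := by rw [← Matrix.conjTranspose_eq_transpose_of_trivial, hL.eq]
  have e0 : R⁻¹ * Ψᵀ = Ψ * R⁻¹ := by
    calc R⁻¹ * Ψᵀ = R⁻¹ * (Ψᵀ * R) * R⁻¹ := by
          simp only [Matrix.mul_assoc, hR.mul_inv_self, Matrix.mul_one]
      _ = Ψ * R⁻¹ := by
          rw [hsymm, ← Matrix.mul_assoc, hR.inv_mul_self, Matrix.one_mul]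
  have e1 : (Ψ * R⁻¹ * H).trace = 2 * (Ψ * L).trace := by
    have e2 : (Ψ * R⁻¹ * (R * L)).trace = (Ψ * L).trace := by
      rw [Matrix.mul_assoc, ← Matrix.mul_assoc R⁻¹, hR.inv_mul_self, Matrix.one_mul]
    have e3 : (Ψ * R⁻¹ * (L * R)).trace = (Ψᵀ * L).trace := by
      rw [← e0, ← Matrix.mul_assoc, Matrix.trace_mul_comm, ← Matrix.mul_assoc, ← Matrix.mul_assoc,
        hR.mul_inv_self, Matrix.one_mul]
    have e4 : (Ψᵀ * L).trace = (Ψ * L).trace := by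
      rw [← Matrix.trace_transpose, Matrix.transpose_mul, Matrix.transpose_transpose, hLt,
        Matrix.trace_mul_comm]
    rw [← hLH, Matrix.mul_add, Matrix.trace_add, e2, e3, e4]
    ring
  rw [e0, ← two_smul ℝ (Ψ * R⁻¹), smul_smul, Matrix.smul_mul, Matrix.trace_smul, e1, smul_eq_mul,
    ← Matrix.trace_transpose, Matrix.transpose_mul, Matrix.transpose_transpose, hLt,
    Matrix.trace_mul_comm]
  ring

/-- The gradient of the risk function. -/
theorem hasDerivAt_riskFun (hν : IsCentralLaw ν) (hΦ : ContDiff ℝ 1 Φ₀)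
    (hdom : DominatedNear ν Φ₀ m S) (hS : S.PosDef)
    (hint : ∀ (m : Vec d) (S : Mat d), S.PosDef →
      Integrable (fun z => Φ₀ (lsMap m S z)) (ν : Measure (Vec d)))
    (h : Vec d) {H : Mat d} (hH : H.IsHermitian) :
    HasDerivAt (fun ε : ℝ => riskFun ν Φ₀ (m + ε • h) (S + ε • H))
      (inner ℝ (gradM ν Φ₀ m S) h + (gradS ν Φ₀ m S * H).trace) 0 := by
  obtain ⟨L, hLh, hLH, hL⟩ := exists_hasDerivAt_sqrt hS hH
  have h1 := hasDerivAt_riskFun_line hΦ hdom hS hint h hH hL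
  rwa [integral_fderiv_affine hΦ hdom hS, trace_psiMat_transpose_mul hν hΦ hdom hS (hint m S hS)
    hLh hLH] at h1

/-- The derivative of the objective along a feasible line vanishes at a maximizer. -/
theorem deriv_objective_eq_zero (hν : IsCentralLaw ν) {γ : ℝ} {w : Fin n → ℝ}
    (hw : w ∈ stdSimplex ℝ (Fin n)) {ms : Fin n → Vec d} {Ss : Fin n → Mat d}
    (hSs : ∀ i, (Ss i).PosDef) (hΦ : ContDiff ℝ 1 Φ₀) (hdom : DominatedNear ν Φ₀ m S)
    (hS : S.PosDef)
    (hint : ∀ (m : Vec d) (S : Mat d), S.PosDef →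
      Integrable (fun z => Φ₀ (lsMap m S z)) (ν : Measure (Vec d)))
    (hmax : IsMaxOn (objective ν Φ₀ γ w ms Ss) (feasible d) (m, S))
    (h : Vec d) {H : Mat d} (hH : H.IsHermitian) :
    inner ℝ (gradM ν Φ₀ m S) h + (gradS ν Φ₀ m S * H).trace - 1 / (2 * γ) *
      (2 * inner ℝ (m - meanBary w ms) h +
        ∑ i, w i * (H.trace - (brenier S (Ss i) * H).trace)) = 0 := by
  have hd : HasDerivAt (fun ε : ℝ => objective ν Φ₀ γ w ms Ss (m + ε • h, S + ε • H))
      (inner ℝ (gradM ν Φ₀ m S) h + (gradS ν Φ₀ m S * H).trace - 1 / (2 * γ) *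
        (2 * inner ℝ (m - meanBary w ms) h +
          ∑ i, w i * (H.trace - (brenier S (Ss i) * H).trace))) 0 :=
    (hasDerivAt_riskFun hν hΦ hdom hS hint h hH).sub
      ((((hasDerivAt_locFrechet w hw.2 ms m h).sub_const _).add
        ((hasDerivAt_scatFrechet w hSs hS hH).sub_const _)).const_mul _)
  refine IsLocalMax.hasDerivAt_eq_zero ?_ hd
  have hlim : Filter.Tendsto (fun ε : ℝ => S + ε • H) (𝓝 0) (𝓝 S) := by
    have : Continuous fun ε : ℝ => S + ε • H := by fun_prop
    simpa using this.tendsto 0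
  filter_upwards [hlim.eventually (eventually_posDef hS)] with ε hε
  have h1 : (m + ε • h, S + ε • H) ∈ feasible d := hε (hS.1.add (hH.smul (IsSelfAdjoint.all ε)))
  simpa using hmax h1

theorem gradS_isHermitian (hS : S.PosDef) : (gradS ν Φ₀ m S).IsHermitian := by
  have hR := (sqrt_posDef hS).inv.1
  rw [gradS, Matrix.IsHermitian, Matrix.conjTranspose_smul, Matrix.conjTranspose_add,
    Matrix.conjTranspose_mul, Matrix.conjTranspose_mul, hR.eq,
    ← Matrix.conjTranspose_eq_transpose_of_trivial, Matrix.conjTranspose_conjTranspose, add_comm,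
    star_trivial]

/-- The first order conditions. -/
theorem first_order_conditions (hν : IsCentralLaw ν) {γ : ℝ} (hγ : 0 < γ) {w : Fin n → ℝ}
    (hw : w ∈ stdSimplex ℝ (Fin n)) {ms : Fin n → Vec d} {Ss : Fin n → Mat d}
    (hSs : ∀ i, (Ss i).PosDef) (hΦ : ContDiff ℝ 1 Φ₀) (hdom : DominatedNear ν Φ₀ m S)
    (hS : S.PosDef)
    (hint : ∀ (m : Vec d) (S : Mat d), S.PosDef →
      Integrable (fun z => Φ₀ (lsMap m S z)) (ν : Measure (Vec d)))
    (hmax : IsMaxOn (objective ν Φ₀ γ w ms Ss) (feasible d) (m, S)) :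
    γ • gradM ν Φ₀ m S - (m - ∑ i, w i • ms i) = 0 ∧
      (2 * γ) • (CFC.sqrt S * gradS ν Φ₀ m S * CFC.sqrt S) -
        (S - ∑ i, w i • CFC.sqrt (CFC.sqrt S * Ss i * CFC.sqrt S)) = 0 := by
  have key := fun h H hH => deriv_objective_eq_zero hν hw hSs hΦ hdom hS hint hmax h (H := H) hH
  constructor
  · rw [← inner_self_eq_zero (𝕜 := ℝ)]
    -- The residual is used as its own test direction, with `H = 0`.
    set v := γ • gradM ν Φ₀ m S - (m - ∑ i, w i • ms i) with hv
    have h1 := key v 0 Matrix.isHermitian_zero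
    simp only [Matrix.trace_zero, sub_zero, mul_zero, Finset.sum_const_zero,
      add_zero] at h1
    conv_lhs => enter [2]; rw [hv]
    rw [inner_sub_left, real_inner_smul_left]
    have h2 : inner ℝ (m - ∑ i, w i • ms i) v = inner ℝ (m - meanBary w ms) v := rfl
    rw [h2]
    field_simp at h1
    linarith
  -- The scatter residual before conjugation is hermitian, hence an admissible direction, and
  -- testing with it gives `Tr(G²) = 0`.
  · set G : Mat d := (2 * γ) • gradS ν Φ₀ m S - (1 - ∑ i, w i • brenier S (Ss i)) with hG
    have hGh : G.IsHermitian := by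
      refine ((gradS_isHermitian hS).smul (IsSelfAdjoint.all _)).sub (Matrix.isHermitian_one.sub ?_)
      exact isSelfAdjoint_sum _ fun i _ =>
        (brenier_posDef hS (hSs i)).1.smul (IsSelfAdjoint.all (w i))
    have h1 := key 0 G hGh
    have h2 : (G * G).trace = 0 := by
      have h3 : (G * G).trace = 2 * γ * (gradS ν Φ₀ m S * G).trace -
          ∑ i, w i * (G.trace - (brenier S (Ss i) * G).trace) := by
        conv_lhs => enter [1, 1]; rw [hG]
        simp only [Matrix.sub_mul, Matrix.smul_mul, Matrix.trace_sub,
          Matrix.trace_smul, Matrix.sum_mul, Matrix.trace_sum, smul_eq_mul, mul_sub,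
          Finset.sum_sub_distrib, ← Finset.sum_mul, hw.2, one_mul]
      rw [h3]
      simp only [inner_zero_right, zero_add, mul_zero] at h1
      field_simp at h1
      linarith
    have h4 : G = 0 := by
      rw [← Matrix.trace_conjTranspose_mul_self_eq_zero_iff, hGh.eq, h2]
    have h5 := congrArg (fun X => CFC.sqrt S * X * CFC.sqrt S) h4
    simp only [hG, Matrix.mul_sub, Matrix.sub_mul, Matrix.mul_smul, Matrix.smul_mul,
      Matrix.mul_one, Matrix.mul_zero, Matrix.zero_mul, Matrix.mul_sum, Matrix.sum_mul,
      sqrt_mul_sqrt hS.posSemidef, sqrt_mul_brenier_mul_sqrt hS (hSs _)] at h5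
    exact h5

end RotationInvariance

end BarycentricRisk

open BarycentricRisk in
theorem proposition2p8 {d n : ℕ}
    (ν : ProbabilityMeasure (Vec d)) (hν : IsCentralLaw ν)
    (γ : ℝ) (hγ : 0 < γ)
    (w : Fin n → ℝ) (hw : w ∈ stdSimplex ℝ (Fin n))
    (ms : Fin n → Vec d) (Ss : Fin n → Mat d) (hSs : ∀ i, (Ss i).PosDef)
    (Φ₀ : Vec d → ℝ) (hΦ₀ : Measurable Φ₀)
    (hint : ∀ (m : Vec d) (S : Mat d), S.PosDef →
      Integrable (fun z => Φ₀ (lsMap m S z)) (ν : Measure (Vec d))) :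
    -- the risk measure is the value of the matrix optimization problem
    (wassersteinRisk (lsFamily ν) γ w (fun i => LS ν (ms i) (Ss i)) (fun z => -Φ₀ z) =
        (⨆ p ∈ feasible d, ((objective ν Φ₀ γ w ms Ss p : ℝ) : EReal))) ∧
    -- first order conditions, for a smooth risk mapping
    (ContDiff ℝ 1 Φ₀ → ∀ (m : Vec d) (S : Mat d), S.PosDef → DominatedNear ν Φ₀ m S →
      (∀ (h : Vec d) (H : Mat d), H.IsSymm →
        HasDerivAt (fun ε : ℝ => riskFun ν Φ₀ (m + ε • h) (S + ε • H))
          (inner ℝ (gradM ν Φ₀ m S) h + (gradS ν Φ₀ m S * H).trace) 0) ∧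
      (IsMaxOn (objective ν Φ₀ γ w ms Ss) (feasible d) (m, S) →
        γ • gradM ν Φ₀ m S - (m - ∑ i, w i • ms i) = 0 ∧
        (2 * γ) • (CFC.sqrt S * gradS ν Φ₀ m S * CFC.sqrt S) -
          (S - ∑ i, w i • CFC.sqrt (CFC.sqrt S * Ss i * CFC.sqrt S)) = 0)) :=
  ⟨wassersteinRisk_lsFamily hν hγ hw ms hSs hΦ₀ hint, fun hΦ _ _ hS hdom =>
    ⟨fun h _ hH => hasDerivAt_riskFun hν hΦ hdom hS hint h
      ((Matrix.conjTranspose_eq_transpose_of_trivial _).trans hH),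
      first_order_conditions hν hγ hw hSs hΦ hdom hS hint⟩⟩
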